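/- Let $c\neq 0$ be a real number and let $\tilde M^2_1(4c)$ be a Lorentzian complex space form of complex dimension $2$: a smooth manifold of real dimension $4$ with a pseudo-Riemannian metric $\langle\,,\rangle$ and an almost complex structure $J$ which is orthogonal for the metric and parallel for its Levi-Civita connection, of complex index $1$ (the largest $J$-invariant negative definite subspace of each tangent space has complex dimension $1$), whose curvature tensor is $$\tilde R(X,Y)Z=c\{\langle Y,Z\rangle X-\langle X,Z\rangle Y+\langle JY,Z\rangle JX-\langle JX,Z\rangle JY+2\langle X,JY\rangle JZ\}.$$ Let $M$ be a nonempty surface immersed in $\tilde M^2_1(4c)$ whose induced metric $g$ is Lorentzian (nondegenerate of index $1$), and let $PX$ denote the tangential component of $JX$ for $X$ tangent to $M$. For a real number $\theta$, $M$ is called slant with slant angle $\theta$ if every tangent plane of $M$ has a basis $e_1,e_2$ with $\langle e_1,e_1\rangle=\langle e_2,e_2\rangle=0$, $\langle e_1,e_2\rangle=-1$ and $$Pe_1=(\sinh\theta)\,e_1,\qquad Pe_2=-(\sinh\theta)\,e_2,$$ and Lagrangian if $J$ maps every tangent space of $M$ into the normal space. Suppose that $M$ is minimal (its mean curvature vector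 vanishes at every point) and flat (the curvature tensor of $g$ vanishes). Then, for every real $\theta$, $M$ is slant with slant angle $\theta$ if and only if $\theta=0$ and $M$ is Lagrangian. In particular, the minimal flat slant surfaces in $\tilde M^2_1(4c)$ with $c\neq0$ are exactly the minimal flat Lagrangian ones. -/

import Mathlib

open scoped Manifold ContDiff

noncomputable section

namespace LorentzSurface

/-! ## Pseudo-Riemannian geometry of a coordinate domain

`G` is a metric tensor in coordinates: for `y` in an open subset of the model space `E`,
`G y` is the bilinear form whose values on basis vectors are the coefficients `g_ij(y)`. -/

section Coordinates

variable {E : Type*} [NormedAddCommGroup E] [NormedSpace ℝ E]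

/-- The Levi-Civita connection of `G` on constant (coordinate) vector fields: `∇_u v` at `y`.
It is the Koszul (Christoffel) formula
`2 ⟨∇_u v, w⟩ = (∂_u G)(v, w) + (∂_v G)(u, w) - (∂_w G)(u, v)`
solved with the inverse of the metric, `(G y)⁻¹ : E* → E` (raising the index). -/
def christoffel (G : E → E →L[ℝ] E →L[ℝ] ℝ) (y u v : E) : E :=
  (G y).inverse ((2⁻¹ : ℝ) •
    (fderiv ℝ G y u v + fderiv ℝ G y v u - ((fderiv ℝ G y).flip u).flip v))

/-- The Riemann curvature tensor `R(u, v) w = ∇_u ∇_v w - ∇_v ∇_u w` of `G` at `y`, on constant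
(hence commuting) coordinate vector fields. -/
def curvature (G : E → E →L[ℝ] E →L[ℝ] ℝ) (y u v w : E) : E :=
  fderiv ℝ (fun z => christoffel G z v w) y u - fderiv ℝ (fun z => christoffel G z u w) y v
    + christoffel G y u (christoffel G y v w) - christoffel G y v (christoffel G y u w)

/-- The covariant derivative `(∇_u J) v = ∇_u (J v) - J (∇_u v)` at `y` of a field of
endomorphisms `J`. -/
def covDerivEndo (G : E → E →L[ℝ] E →L[ℝ] ℝ) (J : E → E →L[ℝ] E) (y u v : E) : E :=
  fderiv ℝ J y u v + christoffel G y u (J y v) - J y (christoffel G y u v)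

/-- The trace `∑ g^{ij} h(b_i, b_j)` of `h` with respect to the nondegenerate bilinear form `B`,
written as `∑ h(b_i, ♯b^i)` with `b^i` the dual basis and `♯ = B⁻¹ : E* → E`. -/
def metricTrace [FiniteDimensional ℝ E] {F : Type*} [AddCommGroup F]
    (B : E →L[ℝ] E →L[ℝ] ℝ) (h : E → E → F) : F :=
  ∑ i, h (Module.finBasis ℝ E i)
    (B.inverse (LinearMap.toContinuousLinearMap ((Module.finBasis ℝ E).coord i)))

variable {E' : Type*} [NormedAddCommGroup E'] [NormedSpace ℝ E']

/-- The second fundamental form at `y`, by the formula of Gauss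
`h(u, v) = ∇̃_u v - ∇_u v`, of the map `F` between coordinate domains with metrics `G` (source)
and `G'` (target):
`∂_u ∂_v F + Γ'(∂_u F, ∂_v F) - dF (Γ(u, v))`. -/
def secondFundamentalForm (G : E → E →L[ℝ] E →L[ℝ] ℝ) (G' : E' → E' →L[ℝ] E' →L[ℝ] ℝ)
    (F : E → E') (y u v : E) : E' :=
  fderiv ℝ (fun z => fderiv ℝ F z v) y u
    + christoffel G' (F y) (fderiv ℝ F y u) (fderiv ℝ F y v)
    - fderiv ℝ F y (christoffel G y u v)

/-- The mean curvature vector `H = (1 / dim) trace h` of `F` at `y`. -/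
def meanCurvature [FiniteDimensional ℝ E] (G : E → E →L[ℝ] E →L[ℝ] ℝ)
    (G' : E' → E' →L[ℝ] E' →L[ℝ] ℝ) (F : E → E') (y : E) : E' :=
  (Module.finrank ℝ E : ℝ)⁻¹ • metricTrace (G y) (secondFundamentalForm G G' F y)

end Coordinates

/-! ## Tensor fields on a manifold -/

section Manifold

variable {E : Type*} [NormedAddCommGroup E] [NormedSpace ℝ E]

/-- A field of bilinear forms on the tangent spaces of `M` (no regularity yet). -/
abbrev BilinField (E : Type*) [NormedAddCommGroup E] [NormedSpace ℝ E]
    (M : Type*) [TopologicalSpace M] [ChartedSpace E M] : Type _ :=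
  ∀ x : M, TangentSpace 𝓘(ℝ, E) x →L[ℝ] TangentSpace 𝓘(ℝ, E) x →L[ℝ] ℝ

/-- A field of endomorphisms of the tangent spaces of `M` (no regularity yet). -/
abbrev EndoField (E : Type*) [NormedAddCommGroup E] [NormedSpace ℝ E]
    (M : Type*) [TopologicalSpace M] [ChartedSpace E M] : Type _ :=
  ∀ x : M, TangentSpace 𝓘(ℝ, E) x →L[ℝ] TangentSpace 𝓘(ℝ, E) x

/-- The smooth charts of the manifold `M`. -/
abbrev charts (E : Type*) [NormedAddCommGroup E] [NormedSpace ℝ E]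
    (M : Type*) [TopologicalSpace M] [ChartedSpace E M] : Set (OpenPartialHomeomorph M E) :=
  IsManifold.maximalAtlas 𝓘(ℝ, E) ∞ M

variable {M : Type*} [TopologicalSpace M] [ChartedSpace E M]

/-- The bilinear form `(u, v) ↦ B (A u) (A v)`. -/
def pullForm {V W : Type*} [AddCommGroup V] [Module ℝ V] [TopologicalSpace V]
    [IsTopologicalAddGroup V] [ContinuousSMul ℝ V] [AddCommGroup W] [Module ℝ W]
    [TopologicalSpace W] [IsTopologicalAddGroup W] [ContinuousSMul ℝ W]
    (B : W →L[ℝ] W →L[ℝ] ℝ) (A : V →L[ℝ] W) : V →L[ℝ] V →L[ℝ] ℝ :=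
  (A.precomp ℝ).comp (B.comp A)

theorem pullForm_apply {V W : Type*} [AddCommGroup V] [Module ℝ V] [TopologicalSpace V]
    [IsTopologicalAddGroup V] [ContinuousSMul ℝ V] [AddCommGroup W] [Module ℝ W]
    [TopologicalSpace W] [IsTopologicalAddGroup W] [ContinuousSMul ℝ W]
    (B : W →L[ℝ] W →L[ℝ] ℝ) (A : V →L[ℝ] W) (u v : V) :
    pullForm B A u v = B (A u) (A v) := rfl

/-- The coordinate expression of `g` in the chart `e`; meaningful on `e.target`. -/
def BilinField.inChart (g : BilinField E M) (e : OpenPartialHomeomorph M E) (y : E) :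
    E →L[ℝ] E →L[ℝ] ℝ :=
  pullForm (g (e.symm y)) (mfderiv 𝓘(ℝ, E) 𝓘(ℝ, E) e.symm y)

/-- The coordinate expression of `J` in the chart `e`; meaningful on `e.target`. -/
def EndoField.inChart (J : EndoField E M) (e : OpenPartialHomeomorph M E) (y : E) :
    E →L[ℝ] E :=
  (mfderiv 𝓘(ℝ, E) 𝓘(ℝ, E) e (e.symm y)).comp
    ((J (e.symm y)).comp (mfderiv 𝓘(ℝ, E) 𝓘(ℝ, E) e.symm y))

/-- `g` is a (smooth) pseudo-Riemannian metric on `M`. -/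
structure IsPseudoRiemannian (g : BilinField E M) : Prop where
  symm : ∀ x u v, g x u v = g x v u
  nondegenerate : ∀ x u, (∀ v, g x u v = 0) → u = 0
  smooth : ∀ e ∈ charts E M, ContDiffOn ℝ ∞ (g.inChart e) e.target

/-- The subspace `W` of the tangent space at `x` is negative definite. -/
def IsNegDef (g : BilinField E M) (x : M) (W : Submodule ℝ (TangentSpace 𝓘(ℝ, E) x)) : Prop :=
  ∀ u ∈ W, u ≠ 0 → g x u u < 0

/-- `g` is Lorentzian: its index, the largest dimension of a negative definite subspace of a
tangent space, is `1` everywhere. -/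
def HasIndexOne (g : BilinField E M) : Prop :=
  ∀ x, (∃ W, IsNegDef g x W ∧ Module.finrank ℝ W = 1) ∧
    ∀ W, IsNegDef g x W → Module.finrank ℝ W ≤ 1

/-- The metric `g` is flat. -/
def IsFlat (g : BilinField E M) : Prop :=
  ∀ e ∈ charts E M, ∀ y ∈ e.target, ∀ u v w : E, curvature (g.inChart e) y u v w = 0

/-- `(M, g, J)` is an (indefinite) Kähler manifold: `J` is a smooth almost complex structure,
orthogonal for the pseudo-Riemannian metric `g` and parallel for its Levi-Civita connection. -/
structure IsKahler (g : BilinField E M) (J : EndoField E M) : Prop where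
  metric : IsPseudoRiemannian g
  sq : ∀ x u, J x (J x u) = -u
  orthogonal : ∀ x u v, g x (J x u) (J x v) = g x u v
  smooth : ∀ e ∈ charts E M, ContDiffOn ℝ ∞ (J.inChart e) e.target
  parallel : ∀ e ∈ charts E M, ∀ y ∈ e.target, ∀ u v : E,
    covDerivEndo (g.inChart e) (J.inChart e) y u v = 0

/-- The complex index of `(g, J)` is `i`: at every point, the largest complex (that is,
`J`-invariant) negative definite subspace of the tangent space has complex dimension `i`
(real dimension `2 * i`). -/
def HasComplexIndex (g : BilinField E M) (J : EndoField E M) (i : ℕ) : Prop :=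
  ∀ x, (∃ W, IsNegDef g x W ∧ (∀ u ∈ W, J x u ∈ W) ∧ Module.finrank ℝ W = 2 * i) ∧
    ∀ W, IsNegDef g x W → (∀ u ∈ W, J x u ∈ W) → Module.finrank ℝ W ≤ 2 * i

/-- `(M, g, J)` is a Lorentzian complex space form of constant holomorphic sectional curvature
`4c`: an indefinite Kähler manifold of complex index one with curvature tensor
`R(u,v)w = c (⟨v,w⟩u - ⟨u,w⟩v + ⟨Jv,w⟩Ju - ⟨Ju,w⟩Jv + 2⟨u,Jv⟩Jw)`. -/
structure IsLorentzianComplexSpaceForm (g : BilinField E M) (J : EndoField E M) (c : ℝ) :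
    Prop where
  kahler : IsKahler g J
  complexIndex : HasComplexIndex g J 1
  curvature_eq : ∀ e ∈ charts E M, ∀ y ∈ e.target, ∀ u v w : E,
    curvature (g.inChart e) y u v w = c •
      (g.inChart e y v w • u - g.inChart e y u w • v
        + g.inChart e y (J.inChart e y v) w • J.inChart e y u
        - g.inChart e y (J.inChart e y u) w • J.inChart e y v
        + (2 * g.inChart e y u (J.inChart e y v)) • J.inChart e y w)

/-! ## Submanifolds -/

variable {E' : Type*} [NormedAddCommGroup E'] [NormedSpace ℝ E']
  {N : Type*} [TopologicalSpace N] [ChartedSpace E' N]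

/-- The metric induced on `M` by `f : M → N`. -/
def inducedMetric (g : BilinField E' N) (f : M → N) : BilinField E M := fun x =>
  pullForm (g (f x)) (mfderiv 𝓘(ℝ, E) 𝓘(ℝ, E') f x)

/-- `f : M → N` is a smooth immersion whose induced metric is nondegenerate of index one. -/
structure IsLorentzianImmersion (g : BilinField E' N) (f : M → N) : Prop where
  smooth : ContMDiff 𝓘(ℝ, E) 𝓘(ℝ, E') ∞ f
  immersion : ∀ x, Function.Injective (mfderiv 𝓘(ℝ, E) 𝓘(ℝ, E') f x)
  nondegenerate : ∀ x u, (∀ v, inducedMetric (E := E) g f x u v = 0) → u = 0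
  index : HasIndexOne (inducedMetric (E := E) g f)

/-- `f` is minimal: its mean curvature vector vanishes at each point (computed in any charts
`e` of `M` and `e'` of `N` around the point and its image). -/
def IsMinimal [FiniteDimensional ℝ E] (g : BilinField E' N) (f : M → N) : Prop :=
  ∀ e ∈ charts E M, ∀ e' ∈ charts E' N, ∀ y ∈ e.target, f (e.symm y) ∈ e'.source →
    meanCurvature ((inducedMetric (E := E) g f).inChart e) (g.inChart e')
      (fun z => e' (f (e.symm z))) y = 0

/-- `a` is `P u`, the tangential component of `J u`: the vector `J (df u) - df a` is normal. -/
def IsTangentialPart (g : BilinField E' N) (J : EndoField E' N) (f : M → N) (x : M)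
    (u a : TangentSpace 𝓘(ℝ, E) x) : Prop :=
  ∀ w : TangentSpace 𝓘(ℝ, E) x,
    g (f x) (J (f x) (mfderiv 𝓘(ℝ, E) 𝓘(ℝ, E') f x u) - mfderiv 𝓘(ℝ, E) 𝓘(ℝ, E') f x a)
      (mfderiv 𝓘(ℝ, E) 𝓘(ℝ, E') f x w) = 0

/-- `(u₁, u₂)` is a pseudo-orthonormal pair of tangent vectors of `M` at `x`:
`⟨u₁,u₁⟩ = ⟨u₂,u₂⟩ = 0`, `⟨u₁,u₂⟩ = -1`. -/
def IsPseudoOrthonormal (g : BilinField E M) (x : M) (u₁ u₂ : TangentSpace 𝓘(ℝ, E) x) : Prop :=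
  g x u₁ u₁ = 0 ∧ g x u₂ u₂ = 0 ∧ g x u₁ u₂ = -1

/-- The surface `f : M → N` is slant with slant angle `θ`: its Wirtinger angle is the constant
`θ`, that is, every tangent plane has a pseudo-orthonormal basis `(e₁, e₂)` with
`P e₁ = (sinh θ) e₁` and `P e₂ = -(sinh θ) e₂`. (Exchanging `e₁` and `e₂` changes the sign of
the angle, so the basis has to be chosen suitably at each point.) -/
def IsSlant (g : BilinField E' N) (J : EndoField E' N) (f : M → N) (θ : ℝ) : Prop :=
  ∀ x : M, ∃ e₁ e₂ : TangentSpace 𝓘(ℝ, E) x,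
    IsPseudoOrthonormal (inducedMetric (E := E) g f) x e₁ e₂ ∧
    IsTangentialPart g J f x e₁ (Real.sinh θ • e₁) ∧
    IsTangentialPart g J f x e₂ (-Real.sinh θ • e₂)

/-- `f` is Lagrangian (for a half-dimensional `M`): `J` maps each tangent space of `M` into the
normal space. -/
def IsLagrangian (g : BilinField E' N) (J : EndoField E' N) (f : M → N) : Prop :=
  ∀ (x : M) (u w : TangentSpace 𝓘(ℝ, E) x),
    g (f x) (J (f x) (mfderiv 𝓘(ℝ, E) 𝓘(ℝ, E') f x u)) (mfderiv 𝓘(ℝ, E) 𝓘(ℝ, E') f x w) = 0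

end Manifold

end LorentzSurface

end

/-!
Put `s = sinh θ` and let `h` be the second fundamental form. In a null frame `e₁, e₂` minimality
says `h(e₁, e₂) = 0` and, differentiated, `(∇h)(x; e₁, e₂) = 0`; the Codazzi equation of a flat
surface then reads `(∇h)(e₂; e₁, e₁) = c (e₁ - 3 s J e₁)`. Pairing with `e₂` gives
`⟨h(e₁, e₁), h(e₂, e₂)⟩ = c (1 - 3 s²)`.

If `s ≠ 0`, constancy of `⟨J e₁, e₂⟩ = -s` makes `⟨h(u, v), J w⟩` totally symmetric, and
differentiating this symmetry gives `⟨h(e₁, e₁), J h(e₂, e₂)⟩ = -4 c s`. It also makes `h(e₂, e₂)`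
orthogonal to `J e₁`, hence a multiple of `J e₁ - s e₁`, so that
`⟨h(e₁, e₁), J h(e₂, e₂)⟩ = -s ⟨h(e₁, e₁), h(e₂, e₂)⟩`. Comparing, `3 c s (1 + s²) = 0`, a
contradiction. Finally `s = 0` means `P = 0`.
-/

noncomputable section

set_option maxSynthPendingDepth 3

namespace LorentzSurface

section Calculus

variable {E F₁ F₂ F₃ : Type*} [NormedAddCommGroup E] [NormedSpace ℝ E]
  [NormedAddCommGroup F₁] [NormedSpace ℝ F₁] [NormedAddCommGroup F₂] [NormedSpace ℝ F₂]
  [NormedAddCommGroup F₃] [NormedSpace ℝ F₃] {y : E}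

theorem fderiv_clm_apply₂ {A : E → F₁ →L[ℝ] F₂ →L[ℝ] F₃} {a : E → F₁} {b : E → F₂}
    (hA : DifferentiableAt ℝ A y) (ha : DifferentiableAt ℝ a y) (hb : DifferentiableAt ℝ b y)
    (x : E) :
    fderiv ℝ (fun z => A z (a z) (b z)) y x
      = fderiv ℝ A y x (a y) (b y) + A y (fderiv ℝ a y x) (b y) + A y (a y) (fderiv ℝ b y x) := by
  rw [fderiv_clm_apply (hA.clm_apply ha) hb, fderiv_clm_apply hA ha]
  simp only [add_apply, ContinuousLinearMap.comp_apply, ContinuousLinearMap.flip_apply]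
  abel

theorem fderiv_clm_apply_const {A : E → F₁ →L[ℝ] F₂} (hA : DifferentiableAt ℝ A y) (x : E)
    (a : F₁) : fderiv ℝ (fun z => A z a) y x = fderiv ℝ A y x a := by
  simp [fderiv_clm_apply hA (differentiableAt_const a)]

theorem fderiv_clm_apply₂_const {A : E → F₁ →L[ℝ] F₂ →L[ℝ] F₃} (hA : DifferentiableAt ℝ A y)
    (x : E) (a : F₁) (b : F₂) : fderiv ℝ (fun z => A z a b) y x = fderiv ℝ A y x a b := by
  simp [fderiv_clm_apply₂ hA (differentiableAt_const a) (differentiableAt_const b)]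

theorem fderiv_fderiv_apply_comm {F : E → F₁} (hF : ContDiffAt ℝ ∞ F y) (u v : E) :
    fderiv ℝ (fderiv ℝ F) y u v = fderiv ℝ (fderiv ℝ F) y v u :=
  hF.isSymmSndFDerivAt (by simpa using ENat.LEInfty.out) u v

end Calculus

theorem isInvertible_of_nondegenerate {E : Type*} [NormedAddCommGroup E] [NormedSpace ℝ E]
    [FiniteDimensional ℝ E] {B : E →L[ℝ] E →L[ℝ] ℝ} (hB : ∀ u, (∀ v, B u v = 0) → u = 0) :
    B.IsInvertible := by
  have hinj : Function.Injective (B : E →ₗ[ℝ] E →L[ℝ] ℝ) :=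
    (injective_iff_map_eq_zero _).2 fun u hu => hB u fun v => congr($hu v)
  have hdim : Module.finrank ℝ E = Module.finrank ℝ (E →L[ℝ] ℝ) := by
    rw [← (LinearMap.toContinuousLinearMap (𝕜 := ℝ) (E := E) (F' := ℝ)).finrank_eq]
    exact Subspace.dual_finrank_eq.symm
  exact ⟨(LinearEquiv.ofInjectiveOfFinrankEq _ hinj hdim).toContinuousLinearEquiv, rfl⟩

section Metric

variable {E : Type*} [NormedAddCommGroup E] [NormedSpace ℝ E]

/-- `G` is a smooth pseudo-Riemannian metric on the open subset `U` of the model space. -/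
structure IsMetricOn (G : E → E →L[ℝ] E →L[ℝ] ℝ) (U : Set E) : Prop where
  isOpen : IsOpen U
  smooth : ContDiffOn ℝ ∞ G U
  symm : ∀ y ∈ U, ∀ u v, G y u v = G y v u
  nondegenerate : ∀ y ∈ U, ∀ u, (∀ v, G y u v = 0) → u = 0

/-- The Christoffel symbols `christoffel G y` as a continuous bilinear map, so that they can be
differentiated in `y`. -/
def christoffelCLM (G : E → E →L[ℝ] E →L[ℝ] ℝ) (y : E) : E →L[ℝ] E →L[ℝ] E :=
  (ContinuousLinearMap.compL ℝ E (E →L[ℝ] ℝ) E (G y).inverse).comp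
    ((2⁻¹ : ℝ) • (fderiv ℝ G y + (fderiv ℝ G y).flip
      - (ContinuousLinearMap.flipₗᵢ ℝ E E ℝ).toContinuousLinearEquiv.toContinuousLinearMap.comp
          (fderiv ℝ G y).flip))

theorem christoffelCLM_apply (G : E → E →L[ℝ] E →L[ℝ] ℝ) (y u v : E) :
    christoffelCLM G y u v = christoffel G y u v := rfl

namespace IsMetricOn

variable {G : E → E →L[ℝ] E →L[ℝ] ℝ} {U : Set E} (hG : IsMetricOn G U) {y : E} (hy : y ∈ U)

include hG hy

theorem contDiffAt : ContDiffAt ℝ ∞ G y :=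
  hG.smooth.contDiffAt (hG.isOpen.mem_nhds hy)

theorem differentiableAt : DifferentiableAt ℝ G y :=
  (hG.contDiffAt hy).differentiableAt (by simp)

theorem differentiableAt_apply (u v : E) : DifferentiableAt ℝ (fun z => G z u v) y :=
  ((hG.differentiableAt hy).clm_apply (differentiableAt_const u)).clm_apply
    (differentiableAt_const v)

theorem fderiv_symm (x u v : E) : fderiv ℝ G y x u v = fderiv ℝ G y x v u := by
  have hGd := hG.differentiableAt hy
  have hflip : (fun z => G z u v) =ᶠ[nhds y] fun z => G z v u :=
    Filter.eventuallyEq_of_mem (hG.isOpen.mem_nhds hy) fun z hz => hG.symm z hz u v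
  rw [← fderiv_clm_apply₂_const hGd, hflip.fderiv_eq, fderiv_clm_apply₂_const hGd]

theorem christoffel_symm (u v : E) : christoffel G y u v = christoffel G y v u := by
  unfold christoffel
  congr 2
  ext w
  simp [hG.fderiv_symm hy w u v, add_comm]

variable [FiniteDimensional ℝ E]

theorem isInvertible : (G y).IsInvertible :=
  isInvertible_of_nondegenerate (hG.nondegenerate y hy)

theorem two_mul_apply_christoffel (u v w : E) :
    2 * G y (christoffel G y u v) w
      = fderiv ℝ G y u v w + fderiv ℝ G y v u w - fderiv ℝ G y w u v := by
  rw [christoffel, (hG.isInvertible hy).self_apply_inverse]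
  simp

theorem fderiv_eq (x u v : E) : fderiv ℝ G y x u v
    = G y (christoffel G y x u) v + G y u (christoffel G y x v) := by
  linarith [hG.two_mul_apply_christoffel hy x u v, hG.two_mul_apply_christoffel hy x v u,
    hG.fderiv_symm hy x u v, hG.fderiv_symm hy v x u, hG.fderiv_symm hy u v x,
    hG.symm y hy u (christoffel G y x v)]

theorem contDiffAt_christoffelCLM : ContDiffAt ℝ ∞ (christoffelCLM G) y := by
  have hd : ContDiffAt ℝ ∞ (fderiv ℝ G) y := (hG.contDiffAt hy).fderiv_right (m := ∞) le_rfl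
  have hflip : ContDiffAt ℝ ∞ (fun z => (fderiv ℝ G z).flip) y :=
    (ContinuousLinearMap.flipₗᵢ ℝ E E (E →L[ℝ] ℝ)).contDiff.contDiffAt.comp y hd
  have hinv : ContDiffAt ℝ ∞ (fun z => (G z).inverse) y :=
    ContDiffAt.comp y (hG.isInvertible hy).contDiffAt_map_inverse (hG.contDiffAt hy)
  exact ((ContinuousLinearMap.compL ℝ E (E →L[ℝ] ℝ) E).contDiff.contDiffAt.comp y hinv).clm_comp
    (((hd.add hflip).sub (contDiffAt_const.clm_comp hflip)).const_smul _)

theorem differentiableAt_christoffelCLM : DifferentiableAt ℝ (christoffelCLM G) y :=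
  (hG.contDiffAt_christoffelCLM hy).differentiableAt (by simp)

theorem curvature_eq (u v w : E) :
    curvature G y u v w
      = fderiv ℝ (christoffelCLM G) y u v w - fderiv ℝ (christoffelCLM G) y v u w
        + christoffel G y u (christoffel G y v w) - christoffel G y v (christoffel G y u w) := by
  have hΓ := hG.differentiableAt_christoffelCLM hy
  rw [← fderiv_clm_apply₂_const hΓ, ← fderiv_clm_apply₂_const hΓ]
  rfl

end IsMetricOn

end Metric

section CovariantDerivative

variable {E : Type*} [NormedAddCommGroup E] [NormedSpace ℝ E]
  {E' : Type*} [NormedAddCommGroup E'] [NormedSpace ℝ E']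

/-- The covariant derivative at `y` in the direction `x` of a vector field `W` along the map `F`
into a coordinate domain with metric `G'`. -/
def covDerivAlong (G' : E' → E' →L[ℝ] E' →L[ℝ] ℝ) (F W : E → E') (y x : E) : E' :=
  fderiv ℝ W y x + christoffel G' (F y) (fderiv ℝ F y x) (W y)

/-- The covariant Hessian `(u, v) ↦ ∇_u (∂_v F)` at `y` of a map `F` from an open subset of a
vector space (with its flat connection) into a coordinate domain with metric `G'`. -/
def covHessian (G' : E' → E' →L[ℝ] E' →L[ℝ] ℝ) (F : E → E') (y : E) : E →L[ℝ] E →L[ℝ] E' :=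
  fderiv ℝ (fderiv ℝ F) y + (christoffelCLM G' (F y)).bilinearComp (fderiv ℝ F y) (fderiv ℝ F y)

variable {G' : E' → E' →L[ℝ] E' →L[ℝ] ℝ} {V : Set E'} {F W : E → E'} {y : E}

theorem covHessian_apply (u v : E) : covHessian G' F y u v
    = fderiv ℝ (fderiv ℝ F) y u v + christoffel G' (F y) (fderiv ℝ F y u) (fderiv ℝ F y v) := rfl

theorem covDerivAlong_congr {W₁ W₂ : E → E'} (h : W₁ =ᶠ[nhds y] W₂) (x : E) :
    covDerivAlong G' F W₁ y x = covDerivAlong G' F W₂ y x := by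
  simp only [covDerivAlong, h.fderiv_eq, h.self_of_nhds]

theorem covDerivAlong_add {W₁ W₂ : E → E'} (h₁ : DifferentiableAt ℝ W₁ y)
    (h₂ : DifferentiableAt ℝ W₂ y) (x : E) :
    covDerivAlong G' F (fun z => W₁ z + W₂ z) y x
      = covDerivAlong G' F W₁ y x + covDerivAlong G' F W₂ y x := by
  simp only [covDerivAlong, ← christoffelCLM_apply, fderiv_fun_add h₁ h₂, add_apply, map_add]
  abel

theorem covDerivAlong_sub {W₁ W₂ : E → E'} (h₁ : DifferentiableAt ℝ W₁ y)
    (h₂ : DifferentiableAt ℝ W₂ y) (x : E) :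
    covDerivAlong G' F (fun z => W₁ z - W₂ z) y x
      = covDerivAlong G' F W₁ y x - covDerivAlong G' F W₂ y x := by
  simp only [covDerivAlong, ← christoffelCLM_apply, fderiv_fun_sub h₁ h₂, sub_apply, map_sub]
  abel

theorem covDerivAlong_smul {a : E → ℝ} (ha : DifferentiableAt ℝ a y)
    (hW : DifferentiableAt ℝ W y) (x : E) :
    covDerivAlong G' F (fun z => a z • W z) y x
      = fderiv ℝ a y x • W y + a y • covDerivAlong G' F W y x := by
  simp only [covDerivAlong, ← christoffelCLM_apply, fderiv_fun_smul ha hW, add_apply,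
    smul_apply, ContinuousLinearMap.smulRight_apply, map_smul, smul_add]
  abel

theorem covDerivAlong_fderiv_apply (hF : DifferentiableAt ℝ (fderiv ℝ F) y) {w : E → E}
    (hw : DifferentiableAt ℝ w y) (x : E) :
    covDerivAlong G' F (fun z => fderiv ℝ F z (w z)) y x
      = covHessian G' F y x (w y) + fderiv ℝ F y (fderiv ℝ w y x) := by
  rw [covDerivAlong, covHessian_apply, fderiv_clm_apply hF hw]
  simp only [add_apply, ContinuousLinearMap.comp_apply, ContinuousLinearMap.flip_apply]
  abel

theorem covDerivAlong_fderiv_apply_const (hF : DifferentiableAt ℝ (fderiv ℝ F) y) (x v : E) :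
    covDerivAlong G' F (fun z => fderiv ℝ F z v) y x = covHessian G' F y x v := by
  simp [covDerivAlong_fderiv_apply hF (differentiableAt_const v)]

theorem covDerivAlong_endo {J : E' → E' →L[ℝ] E'} (hJ : DifferentiableAt ℝ J (F y))
    (hpar : ∀ u v, covDerivEndo G' J (F y) u v = 0)
    (hF : DifferentiableAt ℝ F y) (hW : DifferentiableAt ℝ W y) (x : E) :
    covDerivAlong G' F (fun z => J (F z) (W z)) y x = J (F y) (covDerivAlong G' F W y x) := by
  have hpar' := sub_eq_zero.1 (hpar (fderiv ℝ F y x) (W y))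
  have hchain : fderiv ℝ (fun z => J (F z)) y x = fderiv ℝ J (F y) (fderiv ℝ F y x) :=
    congr($(fderiv_fun_comp y hJ hF) x)
  simp only [covDerivAlong, fderiv_clm_apply (hJ.fun_comp' y hF) hW, map_add, add_apply,
    ContinuousLinearMap.comp_apply, ContinuousLinearMap.flip_apply, hchain, ← hpar']
  abel

namespace IsMetricOn

variable (hG' : IsMetricOn G' V) (hy : F y ∈ V)

include hG' hy

theorem covHessian_symm (hF : ContDiffAt ℝ ∞ F y) (u v : E) :
    covHessian G' F y u v = covHessian G' F y v u := by
  rw [covHessian_apply, covHessian_apply, fderiv_fderiv_apply_comm hF, hG'.christoffel_symm hy]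

variable [FiniteDimensional ℝ E']

theorem fderiv_along (hF : DifferentiableAt ℝ F y) {W₁ W₂ : E → E'}
    (h₁ : DifferentiableAt ℝ W₁ y) (h₂ : DifferentiableAt ℝ W₂ y) (x : E) :
    fderiv ℝ (fun z => G' (F z) (W₁ z) (W₂ z)) y x
      = G' (F y) (covDerivAlong G' F W₁ y x) (W₂ y)
        + G' (F y) (W₁ y) (covDerivAlong G' F W₂ y x) := by
  have hGd := hG'.differentiableAt hy
  have hchain : fderiv ℝ (fun z => G' (F z)) y x = fderiv ℝ G' (F y) (fderiv ℝ F y x) :=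
    congr($(fderiv_fun_comp y hGd hF) x)
  simp only [fderiv_clm_apply₂ (hGd.fun_comp' y hF) h₁ h₂, hchain, hG'.fderiv_eq hy, covDerivAlong,
    map_add, add_apply]
  ring

theorem differentiableAt_covHessian (hF : ContDiffAt ℝ ∞ F y) (u v : E) :
    DifferentiableAt ℝ (fun z => covHessian G' F z u v) y := by
  have hdF : ContDiffAt ℝ ∞ (fderiv ℝ F) y := hF.fderiv_right (m := ∞) le_rfl
  have hddF : ContDiffAt ℝ ∞ (fderiv ℝ (fderiv ℝ F)) y := hdF.fderiv_right (m := ∞) le_rfl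
  have hΓ : ContDiffAt ℝ ∞ (fun z => christoffelCLM G' (F z)) y :=
    (hG'.contDiffAt_christoffelCLM hy).comp y hF
  have hHess := (hddF.clm_apply (contDiffAt_const (c := u))).clm_apply (contDiffAt_const (c := v))
  have hΓuv := (hΓ.clm_apply (hdF.clm_apply (contDiffAt_const (c := u)))).clm_apply
    (hdF.clm_apply (contDiffAt_const (c := v)))
  exact (hHess.add hΓuv).differentiableAt (by simp)

theorem covDerivAlong_covHessian (hF : ContDiffAt ℝ ∞ F y) (x u v : E) :
    covDerivAlong G' F (fun z => covHessian G' F z u v) y x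
      = fderiv ℝ (fderiv ℝ (fderiv ℝ F)) y x u v
        + fderiv ℝ (christoffelCLM G') (F y) (fderiv ℝ F y x) (fderiv ℝ F y u) (fderiv ℝ F y v)
        + christoffel G' (F y) (fderiv ℝ (fderiv ℝ F) y x u) (fderiv ℝ F y v)
        + christoffel G' (F y) (fderiv ℝ F y u) (fderiv ℝ (fderiv ℝ F) y x v)
        + christoffel G' (F y) (fderiv ℝ F y x) (covHessian G' F y u v) := by
  have hdF : ContDiffAt ℝ ∞ (fderiv ℝ F) y := hF.fderiv_right (m := ∞) le_rfl
  have hFd : DifferentiableAt ℝ F y := hF.differentiableAt (by simp)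
  have hdFd : DifferentiableAt ℝ (fderiv ℝ F) y := hdF.differentiableAt (by simp)
  have hddFd : DifferentiableAt ℝ (fderiv ℝ (fderiv ℝ F)) y :=
    (hdF.fderiv_right (m := ∞) le_rfl).differentiableAt (by simp)
  have hΓ := hG'.differentiableAt_christoffelCLM hy
  have hchain : fderiv ℝ (fun z => christoffelCLM G' (F z)) y x
      = fderiv ℝ (christoffelCLM G') (F y) (fderiv ℝ F y x) := congr($(fderiv_fun_comp y hΓ hFd) x)
  have hdFd_apply (w : E) : DifferentiableAt ℝ (fun z => fderiv ℝ F z w) y :=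
    hdFd.clm_apply (differentiableAt_const w)
  simp only [covDerivAlong, covHessian_apply, ← christoffelCLM_apply]
  rw [fderiv_fun_add ((hddFd.clm_apply (differentiableAt_const u)).clm_apply
      (differentiableAt_const v)) (((hΓ.fun_comp' y hFd).clm_apply (hdFd_apply u)).clm_apply
      (hdFd_apply v)), add_apply, fderiv_clm_apply₂_const hddFd,
    fderiv_clm_apply₂ (hΓ.fun_comp' y hFd) (hdFd_apply u) (hdFd_apply v), hchain,
    fderiv_clm_apply_const hdFd, fderiv_clm_apply_const hdFd]
  abel

theorem covDerivAlong_covHessian_sub (hF : ContDiffAt ℝ ∞ F y) (x u v : E) :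
    covDerivAlong G' F (fun z => covHessian G' F z u v) y x
      - covDerivAlong G' F (fun z => covHessian G' F z x v) y u
      = curvature G' (F y) (fderiv ℝ F y x) (fderiv ℝ F y u) (fderiv ℝ F y v) := by
  have hthird : fderiv ℝ (fderiv ℝ (fderiv ℝ F)) y x u v
      = fderiv ℝ (fderiv ℝ (fderiv ℝ F)) y u x v :=
    congr($(fderiv_fderiv_apply_comm (hF.fderiv_right (m := ∞) le_rfl) x u) v)
  rw [hG'.covDerivAlong_covHessian hy hF, hG'.covDerivAlong_covHessian hy hF,
    hG'.curvature_eq hy, hthird, fderiv_fderiv_apply_comm hF u x]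
  simp only [covHessian_apply, ← christoffelCLM_apply, map_add]
  abel

end IsMetricOn

end CovariantDerivative

section CoordinateImmersion

variable {E : Type*} [NormedAddCommGroup E] [NormedSpace ℝ E]
  {E' : Type*} [NormedAddCommGroup E'] [NormedSpace ℝ E']

/-- `F` is a smooth isometric immersion of the coordinate domain `U` with metric `G` into the
coordinate domain `V` with metric `G'`. It is an immersion because `G` is nondegenerate. -/
structure IsCoordinateImmersion (U : Set E) (V : Set E') (G : E → E →L[ℝ] E →L[ℝ] ℝ)
    (G' : E' → E' →L[ℝ] E' →L[ℝ] ℝ) (F : E → E') : Prop where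
  source : IsMetricOn G U
  target : IsMetricOn G' V
  mapsTo : ∀ y ∈ U, F y ∈ V
  smooth : ContDiffOn ℝ ∞ F U
  induced : ∀ y ∈ U, ∀ u v, G y u v = G' (F y) (fderiv ℝ F y u) (fderiv ℝ F y v)

theorem IsMetricOn.of_induced [FiniteDimensional ℝ E] {U : Set E} {V : Set E'}
    {G : E → E →L[ℝ] E →L[ℝ] ℝ} {G' : E' → E' →L[ℝ] E' →L[ℝ] ℝ} {F : E → E'}
    (hU : IsOpen U) (hG' : IsMetricOn G' V) (hmaps : ∀ y ∈ U, F y ∈ V)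
    (hF : ContDiffOn ℝ ∞ F U)
    (hG : ∀ y ∈ U, ∀ u v, G y u v = G' (F y) (fderiv ℝ F y u) (fderiv ℝ F y v))
    (hnd : ∀ y ∈ U, ∀ u, (∀ v, G y u v = 0) → u = 0) : IsMetricOn G U where
  isOpen := hU
  smooth := by
    have hdF : ContDiffOn ℝ ∞ (fderiv ℝ F) U := hF.fderiv_of_isOpen hU le_rfl
    refine contDiffOn_clm_apply.2 fun u => contDiffOn_clm_apply.2 fun v => ?_
    exact (((hG'.smooth.comp hF hmaps).clm_apply (hdF.clm_apply contDiffOn_const)).clm_apply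
      (hdF.clm_apply contDiffOn_const)).congr fun z hz => hG z hz u v
  symm y hy u v := by rw [hG y hy, hG y hy, hG'.symm _ (hmaps y hy)]
  nondegenerate := hnd

/-- The second fundamental form `secondFundamentalForm G G' F y` as a continuous bilinear map. -/
def secondFundamentalCLM (G : E → E →L[ℝ] E →L[ℝ] ℝ) (G' : E' → E' →L[ℝ] E' →L[ℝ] ℝ)
    (F : E → E') (y : E) : E →L[ℝ] E →L[ℝ] E' :=
  covHessian G' F y - (ContinuousLinearMap.compL ℝ E E E' (fderiv ℝ F y)).comp (christoffelCLM G y)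

/-- The covariant derivative `(∇_x h)(u, v) = ∇_x (h(u, v)) - h(∇_x u, v) - h(u, ∇_x v)` of the
second fundamental form `h`, as a vector of the ambient space: its normal component is the
derivative for the normal connection. -/
def covDerivSecondFundamental (G : E → E →L[ℝ] E →L[ℝ] ℝ) (G' : E' → E' →L[ℝ] E' →L[ℝ] ℝ)
    (F : E → E') (y x u v : E) : E' :=
  covDerivAlong G' F (fun z => secondFundamentalCLM G G' F z u v) y x
    - secondFundamentalCLM G G' F y (christoffel G y x u) v
    - secondFundamentalCLM G G' F y u (christoffel G y x v)

theorem covHessian_eq (G : E → E →L[ℝ] E →L[ℝ] ℝ) (G' : E' → E' →L[ℝ] E' →L[ℝ] ℝ)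
    (F : E → E') (y u v : E) : covHessian G' F y u v
      = secondFundamentalCLM G G' F y u v + fderiv ℝ F y (christoffel G y u v) :=
  (sub_add_cancel _ _).symm

namespace IsCoordinateImmersion

variable {U : Set E} {V : Set E'} {G : E → E →L[ℝ] E →L[ℝ] ℝ}
  {G' : E' → E' →L[ℝ] E' →L[ℝ] ℝ} {F : E → E'} (H : IsCoordinateImmersion U V G G' F)
  {y : E} (hy : y ∈ U)

include H hy

theorem mem_nhds : U ∈ nhds y := H.source.isOpen.mem_nhds hy

theorem contDiffAt : ContDiffAt ℝ ∞ F y := H.smooth.contDiffAt (H.mem_nhds hy)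

theorem differentiableAt : DifferentiableAt ℝ F y := (H.contDiffAt hy).differentiableAt (by simp)

theorem differentiableAt_fderiv : DifferentiableAt ℝ (fderiv ℝ F) y :=
  ((H.contDiffAt hy).fderiv_right (m := ∞) le_rfl).differentiableAt (by simp)

theorem differentiableAt_fderiv_apply (v : E) : DifferentiableAt ℝ (fun z => fderiv ℝ F z v) y :=
  (H.differentiableAt_fderiv hy).clm_apply (differentiableAt_const v)

theorem secondFundamentalCLM_apply (u v : E) :
    secondFundamentalCLM G G' F y u v = secondFundamentalForm G G' F y u v := by
  rw [secondFundamentalForm, fderiv_clm_apply_const (H.differentiableAt_fderiv hy)]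
  rfl

theorem secondFundamentalCLM_symm (u v : E) :
    secondFundamentalCLM G G' F y u v = secondFundamentalCLM G G' F y v u := by
  have hHess := H.target.covHessian_symm (H.mapsTo y hy) (H.contDiffAt hy) u v
  rwa [covHessian_eq G, covHessian_eq G, H.source.christoffel_symm hy, add_left_inj] at hHess

theorem covDerivSecondFundamental_symm (x u v : E) :
    covDerivSecondFundamental G G' F y x u v = covDerivSecondFundamental G G' F y x v u := by
  have hev : (fun z => secondFundamentalCLM G G' F z u v) =ᶠ[nhds y]
      fun z => secondFundamentalCLM G G' F z v u :=
    Filter.eventuallyEq_of_mem (H.mem_nhds hy) fun z hz => H.secondFundamentalCLM_symm hz u v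
  rw [covDerivSecondFundamental, covDerivSecondFundamental, covDerivAlong_congr hev,
    H.secondFundamentalCLM_symm hy (christoffel G y x u),
    H.secondFundamentalCLM_symm hy u (christoffel G y x v)]
  abel

theorem differentiableAt_fderiv_christoffel [FiniteDimensional ℝ E] (u v : E) :
    DifferentiableAt ℝ (fun z => fderiv ℝ F z (christoffel G z u v)) y :=
  (H.differentiableAt_fderiv hy).clm_apply <|
    ((H.source.differentiableAt_christoffelCLM hy).clm_apply (differentiableAt_const u)).clm_apply
      (differentiableAt_const v)

variable [FiniteDimensional ℝ E']

theorem fderiv_inner {W₁ W₂ : E → E'} (h₁ : DifferentiableAt ℝ W₁ y)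
    (h₂ : DifferentiableAt ℝ W₂ y) (x : E) :
    fderiv ℝ (fun z => G' (F z) (W₁ z) (W₂ z)) y x
      = G' (F y) (covDerivAlong G' F W₁ y x) (W₂ y)
        + G' (F y) (W₁ y) (covDerivAlong G' F W₂ y x) :=
  H.target.fderiv_along (H.mapsTo y hy) (H.differentiableAt hy) h₁ h₂ x

variable [FiniteDimensional ℝ E]

theorem inner_secondFundamentalCLM_add (x u v : E) :
    G' (F y) (secondFundamentalCLM G G' F y x u) (fderiv ℝ F y v)
      + G' (F y) (fderiv ℝ F y u) (secondFundamentalCLM G G' F y x v) = 0 := by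
  have hev : (fun z => G z u v) =ᶠ[nhds y]
      fun z => G' (F z) (fderiv ℝ F z u) (fderiv ℝ F z v) :=
    Filter.eventuallyEq_of_mem (H.mem_nhds hy) fun z hz => H.induced z hz u v
  have hd := congr($(hev.fderiv_eq (𝕜 := ℝ)) x)
  rw [fderiv_clm_apply₂_const (H.source.differentiableAt hy), H.source.fderiv_eq hy,
    H.induced y hy, H.induced y hy, H.fderiv_inner hy (H.differentiableAt_fderiv_apply hy u)
      (H.differentiableAt_fderiv_apply hy v),
    covDerivAlong_fderiv_apply_const (H.differentiableAt_fderiv hy),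
    covDerivAlong_fderiv_apply_const (H.differentiableAt_fderiv hy), covHessian_eq G,
    covHessian_eq G] at hd
  simp only [map_add, add_apply] at hd
  linarith

theorem inner_secondFundamentalCLM_fderiv (u v w : E) :
    G' (F y) (secondFundamentalCLM G G' F y u v) (fderiv ℝ F y w) = 0 := by
  -- `⟨h(u, v), w⟩` is symmetric in `u`, `v` and skew in `v`, `w`
  have hskew (x u v : E) : G' (F y) (secondFundamentalCLM G G' F y x u) (fderiv ℝ F y v)
      + G' (F y) (secondFundamentalCLM G G' F y x v) (fderiv ℝ F y u) = 0 := by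
    rw [H.target.symm _ (H.mapsTo y hy) (secondFundamentalCLM G G' F y x v)]
    exact H.inner_secondFundamentalCLM_add hy x u v
  have h₁ := hskew u v w
  have h₂ := hskew v w u
  have h₃ := hskew w u v
  rw [H.secondFundamentalCLM_symm hy v u] at h₂
  rw [H.secondFundamentalCLM_symm hy w u, H.secondFundamentalCLM_symm hy w v] at h₃
  linarith

theorem differentiableAt_secondFundamentalCLM (u v : E) :
    DifferentiableAt ℝ (fun z => secondFundamentalCLM G G' F z u v) y :=
  (H.target.differentiableAt_covHessian (H.mapsTo y hy) (H.contDiffAt hy) u v).sub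
    (H.differentiableAt_fderiv_christoffel hy u v)

theorem covDerivAlong_secondFundamentalCLM (x u v : E) :
    covDerivAlong G' F (fun z => secondFundamentalCLM G G' F z u v) y x
      = covDerivAlong G' F (fun z => covHessian G' F z u v) y x
        - (secondFundamentalCLM G G' F y x (christoffel G y u v)
          + fderiv ℝ F y (christoffel G y x (christoffel G y u v)
            + fderiv ℝ (christoffelCLM G) y x u v)) := by
  have hΓ := H.source.differentiableAt_christoffelCLM hy
  have hΓuv : DifferentiableAt ℝ (fun z => christoffelCLM G z u v) y :=
    (hΓ.clm_apply (differentiableAt_const u)).clm_apply (differentiableAt_const v)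
  have hsub := covDerivAlong_sub (G' := G') (F := F)
    (H.target.differentiableAt_covHessian (H.mapsTo y hy) (H.contDiffAt hy) u v)
    (H.differentiableAt_fderiv_christoffel hy u v) x
  have hdF := covDerivAlong_fderiv_apply (G' := G') (H.differentiableAt_fderiv hy) hΓuv x
  rw [fderiv_clm_apply₂_const hΓ, covHessian_eq G] at hdF
  rw [map_add, ← add_assoc]
  exact hsub.trans congr(_ - $hdF)

theorem covDerivSecondFundamental_sub (x u v : E) :
    covDerivSecondFundamental G G' F y x u v - covDerivSecondFundamental G G' F y u x v
      = curvature G' (F y) (fderiv ℝ F y x) (fderiv ℝ F y u) (fderiv ℝ F y v)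
        - fderiv ℝ F y (curvature G y x u v) := by
  rw [covDerivSecondFundamental, covDerivSecondFundamental,
    H.covDerivAlong_secondFundamentalCLM hy, H.covDerivAlong_secondFundamentalCLM hy,
    ← H.target.covDerivAlong_covHessian_sub (H.mapsTo y hy) (H.contDiffAt hy),
    H.source.curvature_eq hy, H.source.christoffel_symm hy x u]
  simp only [map_add, map_sub]
  abel

theorem inner_covDerivSecondFundamental_fderiv (x u v w : E) :
    G' (F y) (covDerivSecondFundamental G G' F y x u v) (fderiv ℝ F y w)
      = -G' (F y) (secondFundamentalCLM G G' F y u v) (secondFundamentalCLM G G' F y x w) := by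
  have hev : (fun z => G' (F z) (secondFundamentalCLM G G' F z u v) (fderiv ℝ F z w))
      =ᶠ[nhds y] fun _ => 0 :=
    Filter.eventuallyEq_of_mem (H.mem_nhds hy) fun z hz =>
      H.inner_secondFundamentalCLM_fderiv hz u v w
  have hd := congr($(hev.fderiv_eq (𝕜 := ℝ)) x)
  rw [H.fderiv_inner hy (H.differentiableAt_secondFundamentalCLM hy u v)
    (H.differentiableAt_fderiv_apply hy w),
    covDerivAlong_fderiv_apply_const (H.differentiableAt_fderiv hy), covHessian_eq G, map_add,
    H.inner_secondFundamentalCLM_fderiv hy] at hd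
  simp only [fderiv_fun_const, Pi.zero_apply, zero_apply] at hd
  simp only [covDerivSecondFundamental, map_sub, sub_apply,
    H.inner_secondFundamentalCLM_fderiv hy]
  linarith

end IsCoordinateImmersion

end CoordinateImmersion

section NullPair

theorem eq_sum_of_biorthogonal {K V ι : Type*} [Field K] [AddCommGroup V] [Module K V]
    [Fintype ι] [Nonempty ι] [DecidableEq ι] (hcard : Fintype.card ι = Module.finrank K V)
    {b : ι → V} {φ : ι → Module.Dual K V} (hφ : ∀ i j, φ i (b j) = if i = j then 1 else 0)
    (w : V) : w = ∑ i, φ i w • b i := by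
  have hli : LinearIndependent K b := .of_pairwise_dual_eq_zero_one b φ
    (fun i j hij => by simp [hφ, hij]) (fun i => by simp [hφ])
  have hw : w ∈ Submodule.span K (Set.range b) :=
    hli.span_eq_top_of_card_eq_finrank hcard ▸ Submodule.mem_top
  obtain ⟨a, rfl⟩ := (Submodule.mem_span_range_iff_exists_fun K).1 hw
  simp [hφ]

variable {E : Type*} [NormedAddCommGroup E] [NormedSpace ℝ E]

/-- `e₁, e₂` is a pseudo-orthonormal pair for the bilinear form `B`. Both mixed values are fixed,
so that `B` need not be assumed symmetric. -/
structure IsNullPair (B : E →L[ℝ] E →L[ℝ] ℝ) (e₁ e₂ : E) : Prop where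
  self₁ : B e₁ e₁ = 0
  self₂ : B e₂ e₂ = 0
  mixed : B e₁ e₂ = -1
  mixed' : B e₂ e₁ = -1

namespace IsNullPair

variable {B : E →L[ℝ] E →L[ℝ] ℝ} {e₁ e₂ : E} (h : IsNullPair B e₁ e₂)
  (hE : Module.finrank ℝ E = 2)

include h hE

theorem eq_smul_add_smul (u : E) : u = -B u e₂ • e₁ + -B u e₁ • e₂ := by
  have hdual := eq_sum_of_biorthogonal (K := ℝ) (ι := Fin 2) (by simp [hE]) (b := ![e₁, e₂])
    (φ := ![-(B.flip e₂ : E →ₗ[ℝ] ℝ), -(B.flip e₁ : E →ₗ[ℝ] ℝ)])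
    (by simp [Fin.forall_fin_two, h.self₁, h.self₂, h.mixed, h.mixed']) u
  simpa [Fin.sum_univ_two] using hdual

theorem inverse_apply (hB : B.IsInvertible) (φ : E →L[ℝ] ℝ) :
    B.inverse φ = -φ e₂ • e₁ + -φ e₁ • e₂ := by
  simpa only [hB.self_apply_inverse] using h.eq_smul_add_smul hE (B.inverse φ)

variable {F : Type*} [NormedAddCommGroup F] [NormedSpace ℝ F]

theorem metricTrace_eq [FiniteDimensional ℝ E] (hB : B.IsInvertible) (T : E →L[ℝ] E →L[ℝ] F) :
    metricTrace B (fun u v => T u v) = -(T e₂ e₁ + T e₁ e₂) := by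
  have hexp (a b : E) : T a b
      = ∑ i, T (Module.finBasis ℝ E i) ((Module.finBasis ℝ E).coord i a • b) := by
    conv_lhs => rw [← (Module.finBasis ℝ E).sum_repr a, map_sum, sum_apply]
    simp only [map_smul, smul_apply, Module.Basis.coord_apply]
  rw [hexp e₂, hexp e₁, ← Finset.sum_add_distrib, ← Finset.sum_neg_distrib, metricTrace]
  refine Finset.sum_congr rfl fun i _ => ?_
  rw [h.inverse_apply hE hB, ← map_add, ← map_neg]
  simp [add_comm]

theorem det_smul_metricTrace [FiniteDimensional ℝ E] (hB : B.IsInvertible)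
    (T : E →L[ℝ] E →L[ℝ] F) (u v : E) :
    (B u u * B v v - B u v * B v u) • metricTrace B (fun u v => T u v)
      = B v v • T u u - B v u • T u v - B u v • T v u + B u u • T v v := by
  rw [h.metricTrace_eq hE hB]
  obtain ⟨a, b, rfl⟩ : ∃ a b : ℝ, u = a • e₁ + b • e₂ := ⟨_, _, h.eq_smul_add_smul hE u⟩
  obtain ⟨c, d, rfl⟩ : ∃ c d : ℝ, v = c • e₁ + d • e₂ := ⟨_, _, h.eq_smul_add_smul hE v⟩
  simp only [map_add, map_smul, add_apply, smul_apply, smul_eq_mul, h.self₁, h.self₂, h.mixed,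
    h.mixed']
  module

variable {Ω : E →L[ℝ] E →L[ℝ] ℝ} (hΩ : ∀ u v, Ω u v = -Ω v u)

include hΩ

theorem skew_sq_eq (u v : E) :
    Ω u v ^ 2 = Ω e₁ e₂ ^ 2 * (B u v * B v u - B u u * B v v) := by
  have hself (u : E) : Ω u u = 0 := by linarith [hΩ u u]
  obtain ⟨a, b, rfl⟩ : ∃ a b : ℝ, u = a • e₁ + b • e₂ := ⟨_, _, h.eq_smul_add_smul hE u⟩
  obtain ⟨c, d, rfl⟩ : ∃ c d : ℝ, v = c • e₁ + d • e₂ := ⟨_, _, h.eq_smul_add_smul hE v⟩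
  simp only [map_add, map_smul, add_apply, smul_apply, smul_eq_mul, h.self₁, h.self₂, h.mixed,
    h.mixed', hself, hΩ e₂ e₁]
  ring

theorem skew_eq_zero (h₁₂ : Ω e₁ e₂ = 0) (u v : E) : Ω u v = 0 :=
  pow_eq_zero_iff two_ne_zero |>.1 (by rw [h.skew_sq_eq hE hΩ, h₁₂]; ring)

theorem skew_apply_add (u v : E) :
    Ω u e₂ + Ω e₁ v = -Ω e₁ e₂ * (B u e₂ + B v e₁) := by
  have hself (u : E) : Ω u u = 0 := by linarith [hΩ u u]
  rw [h.eq_smul_add_smul hE u, h.eq_smul_add_smul hE v]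
  simp only [map_add, map_smul, add_apply, smul_apply, smul_eq_mul, h.self₁, h.self₂, h.mixed,
    h.mixed', hself]
  ring

end IsNullPair

theorem skew_of_orthogonal {g : E →L[ℝ] E →L[ℝ] ℝ} {j : E →L[ℝ] E} (hsq : ∀ u, j (j u) = -u)
    (horth : ∀ u v, g (j u) (j v) = g u v) (u v : E) : g (j u) v = -g u (j v) := by
  rw [← horth u, hsq, map_neg, neg_neg]

theorem IsNullPair.exists_eq_smul_of_orthogonal (hE : Module.finrank ℝ E = 4)
    {g : E →L[ℝ] E →L[ℝ] ℝ} {j : E →L[ℝ] E} (hsymm : ∀ u v, g u v = g v u)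
    (hsq : ∀ u, j (j u) = -u) (horth : ∀ u v, g (j u) (j v) = g u v)
    {x₁ x₂ : E} (h : IsNullPair g x₁ x₂) {s : ℝ} (hs : g (j x₁) x₂ = -s)
    {w : E} (w₁ : g w x₁ = 0) (w₂ : g w x₂ = 0) (wj : g w (j x₁) = 0) :
    ∃ b : ℝ, w = b • (j x₁ - s • x₁) := by
  -- with `n₁ = J x₁ - s x₁` and `n₂ = J x₂ + s x₂`, the only nonzero products of the frame
  -- `x₁, x₂, n₁, n₂` are `⟨x₁, x₂⟩ = -1` and `⟨n₁, n₂⟩ = -(1 + s²)`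
  have hskew := skew_of_orthogonal hsq horth
  have hself (u : E) : g (j u) u = 0 := by linarith [hskew u u, hsymm u (j u)]
  have hself' (u : E) : g u (j u) = 0 := by rw [hsymm, hself]
  have hs₂₁ : g x₂ (j x₁) = -s := by rw [hsymm, hs]
  have hs₁₂ : g x₁ (j x₂) = s := by linarith [hskew x₁ x₂]
  have hs' : g (j x₂) x₁ = s := by rw [hsymm, hs₁₂]
  have hnorm₁ : (1 + s ^ 2)⁻¹ + (1 + s ^ 2)⁻¹ * (s * s) = 1 := by field_simp
  have hnorm₂ : -((1 + s ^ 2)⁻¹ * (-1 - s * s)) = 1 := by field_simp; ring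
  have hframe := eq_sum_of_biorthogonal (K := ℝ) (ι := Fin 4) (by simp [hE])
    (b := ![x₁, x₂, j x₁ - s • x₁, j x₂ + s • x₂])
    (φ := ![-(g.flip x₂ : E →ₗ[ℝ] ℝ), -(g.flip x₁ : E →ₗ[ℝ] ℝ),
      -(1 + s ^ 2)⁻¹ • (g.flip (j x₂ + s • x₂) : E →ₗ[ℝ] ℝ),
      -(1 + s ^ 2)⁻¹ • (g.flip (j x₁ - s • x₁) : E →ₗ[ℝ] ℝ)])
    (by simp [Fin.forall_fin_succ, h.self₁, h.self₂, h.mixed, h.mixed', horth, hself, hself', hs,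
      hs₂₁, hs₁₂, hs', hnorm₁, hnorm₂]) w
  exact ⟨-((1 + s ^ 2)⁻¹ * g w (j x₂)), by simpa [Fin.sum_univ_four, w₁, w₂, wj] using hframe⟩

theorem exists_null_vector {B : E →L[ℝ] E →L[ℝ] ℝ} {u w : E} (hu : B u u < 0) (hw : w ≠ 0)
    (hww : 0 ≤ B w w) : ∃ e, e ≠ 0 ∧ B e e = 0 := by
  let q (t : ℝ) : ℝ := B ((1 - t) • u + t • w) ((1 - t) • u + t • w)
  have hq : Continuous q := by fun_prop
  obtain ⟨t, -, ht⟩ : (0 : ℝ) ∈ q '' Set.Icc 0 1 :=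
    intermediate_value_Icc zero_le_one hq.continuousOn ⟨by simpa [q] using hu.le, by simpa [q]⟩
  refine ⟨_, fun h0 => ?_, ht⟩
  -- otherwise `u` and `w` would be proportional
  have hprop : t ^ 2 * B w w = (1 - t) ^ 2 * B u u := by
    have htw : t • w = -((1 - t) • u) := eq_neg_of_add_eq_zero_right h0
    have hB := congr(B $htw $htw)
    simp only [map_smul, map_neg, smul_apply, neg_apply, smul_eq_mul] at hB
    linarith
  have ht1 : t = 1 := by
    by_contra hne
    linarith [mul_nonneg (sq_nonneg t) hww,
      mul_pos (sq_pos_of_ne_zero (sub_ne_zero.2 (Ne.symm hne))) (neg_pos.2 hu)]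
  exact hw (by simpa [ht1] using h0)

theorem exists_isNullPair {B : E →L[ℝ] E →L[ℝ] ℝ} (hsymm : ∀ u v, B u v = B v u)
    (hnd : ∀ u, (∀ v, B u v = 0) → u = 0) {e : E} (he : e ≠ 0) (hee : B e e = 0) :
    ∃ e', IsNullPair B e e' := by
  obtain ⟨z, hz⟩ : ∃ z, B e z ≠ 0 := by
    by_contra! hz
    exact he (hnd e hz)
  obtain ⟨z, hez⟩ : ∃ z, B e z = -1 := ⟨-(B e z)⁻¹ • z, by simp [hz]⟩
  have hze : B z e = -1 := by rw [hsymm, hez]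
  refine ⟨z + (B z z / 2) • e, hee, ?_, by simp [hee, hez], by simp [hee, hze]⟩
  simp only [map_add, map_smul, add_apply, smul_apply, smul_eq_mul, hee, hez, hze]
  ring

end NullPair

section SlantImmersion

variable {E : Type*} [NormedAddCommGroup E] [NormedSpace ℝ E]
  {E' : Type*} [NormedAddCommGroup E'] [NormedSpace ℝ E']

/-- An isometric immersion of coordinate domains whose target carries an orthogonal, parallel
complex structure `J`. -/
structure IsKahlerImmersion (U : Set E) (V : Set E') (G : E → E →L[ℝ] E →L[ℝ] ℝ)
    (G' : E' → E' →L[ℝ] E' →L[ℝ] ℝ) (J : E' → E' →L[ℝ] E') (F : E → E') : Prop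
    extends IsCoordinateImmersion U V G G' F where
  smooth_endo : ContDiffOn ℝ ∞ J V
  sq : ∀ y ∈ V, ∀ u, J y (J y u) = -u
  orthogonal : ∀ y ∈ V, ∀ u v, G' y (J y u) (J y v) = G' y u v
  parallel : ∀ y ∈ V, ∀ u v, covDerivEndo G' J y u v = 0

/-- The pullback `(u, v) ↦ ⟨J dF u, dF v⟩` of the Kähler form, that is, `⟨P u, v⟩`. -/
def kahlerForm (G' : E' → E' →L[ℝ] E' →L[ℝ] ℝ) (J : E' → E' →L[ℝ] E') (F : E → E') (y : E) :
    E →L[ℝ] E →L[ℝ] ℝ :=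
  (G' (F y)).bilinearComp ((J (F y)).comp (fderiv ℝ F y)) (fderiv ℝ F y)

/-- The cubic form `(u, v, w) ↦ ⟨h(u, v), J dF w⟩`. -/
def cubicForm (G : E → E →L[ℝ] E →L[ℝ] ℝ) (G' : E' → E' →L[ℝ] E' →L[ℝ] ℝ)
    (J : E' → E' →L[ℝ] E') (F : E → E') (y u v w : E) : ℝ :=
  G' (F y) (secondFundamentalCLM G G' F y u v) (J (F y) (fderiv ℝ F y w))

/-- `(e₁, e₂)` is a pseudo-orthonormal pair at `y` with `⟨P e₁, e₂⟩ = -s`; in dimension two this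
says that `P e₁ = s e₁` and `P e₂ = -s e₂`. -/
structure IsSlantPair (G : E → E →L[ℝ] E →L[ℝ] ℝ) (G' : E' → E' →L[ℝ] E' →L[ℝ] ℝ)
    (J : E' → E' →L[ℝ] E') (F : E → E') (s : ℝ) (y e₁ e₂ : E) : Prop
    extends IsNullPair (G y) e₁ e₂ where
  kahlerForm_eq : kahlerForm G' J F y e₁ e₂ = -s

/-- A Kähler immersion which is slant with slant angle `arsinh s`. -/
structure IsSlantImmersion (U : Set E) (V : Set E') (G : E → E →L[ℝ] E →L[ℝ] ℝ)
    (G' : E' → E' →L[ℝ] E' →L[ℝ] ℝ) (J : E' → E' →L[ℝ] E') (s : ℝ) (F : E → E') : Prop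
    extends IsKahlerImmersion U V G G' J F where
  exists_isSlantPair : ∀ y ∈ U, ∃ e₁ e₂, IsSlantPair G G' J F s y e₁ e₂

/-- The curvature tensor of `G'` on `V` is that of constant holomorphic sectional curvature
`4c`. -/
def HasConstantHolomorphicCurvatureOn (G' : E' → E' →L[ℝ] E' →L[ℝ] ℝ) (J : E' → E' →L[ℝ] E')
    (c : ℝ) (V : Set E') : Prop :=
  ∀ y ∈ V, ∀ u v w, curvature G' y u v w = c •
    (G' y v w • u - G' y u w • v + G' y (J y v) w • J y u - G' y (J y u) w • J y v
      + (2 * G' y u (J y v)) • J y w)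

theorem kahlerForm_apply (G' : E' → E' →L[ℝ] E' →L[ℝ] ℝ) (J : E' → E' →L[ℝ] E') (F : E → E')
    (y u v : E) :
    kahlerForm G' J F y u v = G' (F y) (J (F y) (fderiv ℝ F y u)) (fderiv ℝ F y v) := rfl

variable {U : Set E} {V : Set E'} {G : E → E →L[ℝ] E →L[ℝ] ℝ}
  {G' : E' → E' →L[ℝ] E' →L[ℝ] ℝ} {J : E' → E' →L[ℝ] E'} {F : E → E'} {y : E}

namespace IsKahlerImmersion

variable (H : IsKahlerImmersion U V G G' J F) (hy : y ∈ U)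

include H hy

theorem inner_symm (u v : E') : G' (F y) u v = G' (F y) v u := H.target.symm _ (H.mapsTo y hy) u v

theorem inner_endo (u v : E') : G' (F y) (J (F y) u) v = -G' (F y) u (J (F y) v) :=
  skew_of_orthogonal (H.sq _ (H.mapsTo y hy)) (H.orthogonal _ (H.mapsTo y hy)) u v

theorem kahlerForm_skew (u v : E) : kahlerForm G' J F y u v = -kahlerForm G' J F y v u := by
  rw [kahlerForm_apply, H.inner_endo hy, H.inner_symm hy, kahlerForm_apply]

theorem differentiableAt_endo : DifferentiableAt ℝ J (F y) :=
  (H.smooth_endo.contDiffAt (H.target.isOpen.mem_nhds (H.mapsTo y hy))).differentiableAt (by simp)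

theorem differentiableAt_endo_apply {W : E → E'} (hW : DifferentiableAt ℝ W y) :
    DifferentiableAt ℝ (fun z => J (F z) (W z)) y :=
  ((H.differentiableAt_endo hy).fun_comp' y (H.differentiableAt hy)).clm_apply hW

theorem covDerivAlong_endo_fderiv (x w : E) :
    covDerivAlong G' F (fun z => J (F z) (fderiv ℝ F z w)) y x
      = J (F y) (secondFundamentalCLM G G' F y x w)
        + J (F y) (fderiv ℝ F y (christoffel G y x w)) := by
  rw [covDerivAlong_endo (H.differentiableAt_endo hy) (H.parallel _ (H.mapsTo y hy))
    (H.differentiableAt hy) (H.differentiableAt_fderiv_apply hy w),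
    covDerivAlong_fderiv_apply_const (H.differentiableAt_fderiv hy), covHessian_eq G, map_add]

theorem differentiableAt_kahlerForm (u v : E) :
    DifferentiableAt ℝ (fun z => kahlerForm G' J F z u v) y :=
  (((H.target.differentiableAt (H.mapsTo y hy)).fun_comp' y (H.differentiableAt hy)).clm_apply
    (H.differentiableAt_endo_apply hy (H.differentiableAt_fderiv_apply hy u))).clm_apply
      (H.differentiableAt_fderiv_apply hy v)

variable [FiniteDimensional ℝ E']

theorem fderiv_kahlerForm (x u v : E) :
    fderiv ℝ (fun z => kahlerForm G' J F z u v) y x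
      = kahlerForm G' J F y (christoffel G y x u) v + kahlerForm G' J F y u (christoffel G y x v)
        - cubicForm G G' J F y x u v + cubicForm G G' J F y x v u := by
  simp only [kahlerForm_apply, cubicForm]
  rw [H.fderiv_inner hy (H.differentiableAt_endo_apply hy (H.differentiableAt_fderiv_apply hy u))
    (H.differentiableAt_fderiv_apply hy v), H.covDerivAlong_endo_fderiv hy,
    covDerivAlong_fderiv_apply_const (H.differentiableAt_fderiv hy), covHessian_eq G, map_add,
    map_add, add_apply, H.inner_endo hy (secondFundamentalCLM G G' F y x u),
    H.inner_symm hy _ (secondFundamentalCLM G G' F y x v)]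
  ring

theorem fderiv_cubicForm [FiniteDimensional ℝ E] (x u v w : E) :
    fderiv ℝ (fun z => cubicForm G G' J F z u v w) y x
      = G' (F y) (covDerivSecondFundamental G G' F y x u v) (J (F y) (fderiv ℝ F y w))
        + G' (F y) (secondFundamentalCLM G G' F y u v)
          (J (F y) (secondFundamentalCLM G G' F y x w))
        + cubicForm G G' J F y (christoffel G y x u) v w
        + cubicForm G G' J F y u (christoffel G y x v) w
        + cubicForm G G' J F y u v (christoffel G y x w) := by
  simp only [cubicForm, covDerivSecondFundamental]
  rw [H.fderiv_inner hy (H.differentiableAt_secondFundamentalCLM hy u v)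
    (H.differentiableAt_endo_apply hy (H.differentiableAt_fderiv_apply hy w)),
    H.covDerivAlong_endo_fderiv hy]
  simp only [map_add, map_sub, sub_apply]
  ring

end IsKahlerImmersion

theorem IsSlantImmersion.exists_isNullPair {s : ℝ} (H : IsSlantImmersion U V G G' J s F) :
    ∀ y ∈ U, ∃ e₁ e₂, IsNullPair (G y) e₁ e₂ := fun y hy =>
  (H.exists_isSlantPair y hy).imp fun _ => .imp fun _ h => h.toIsNullPair

namespace IsCoordinateImmersion

theorem isNullPair_fderiv (H : IsCoordinateImmersion U V G G' F) (hy : y ∈ U) {e₁ e₂ : E}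
    (h : IsNullPair (G y) e₁ e₂) :
    IsNullPair (G' (F y)) (fderiv ℝ F y e₁) (fderiv ℝ F y e₂) where
  self₁ := (H.induced y hy _ _).symm.trans h.self₁
  self₂ := (H.induced y hy _ _).symm.trans h.self₂
  mixed := (H.induced y hy _ _).symm.trans h.mixed
  mixed' := (H.induced y hy _ _).symm.trans h.mixed'

variable [FiniteDimensional ℝ E] (H : IsCoordinateImmersion U V G G' F)
  (hE : Module.finrank ℝ E = 2) (hmin : ∀ y ∈ U, meanCurvature G G' F y = 0) (hy : y ∈ U)
  {e₁ e₂ : E} (h : IsNullPair (G y) e₁ e₂)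

include H hE hmin hy

theorem metricTrace_secondFundamentalCLM :
    metricTrace (G y) (fun u v => secondFundamentalCLM G G' F y u v) = 0 := by
  have hH := hmin y hy
  simp only [meanCurvature, hE] at hH
  simpa [H.secondFundamentalCLM_apply hy] using hH

include h

theorem smul_secondFundamentalCLM_add (u v : E) :
    G y v v • secondFundamentalCLM G G' F y u u + G y u u • secondFundamentalCLM G G' F y v v
      = (2 * G y u v) • secondFundamentalCLM G G' F y u v := by
  have htr := h.det_smul_metricTrace hE (H.source.isInvertible hy) (secondFundamentalCLM G G' F y)
    u v
  rw [H.metricTrace_secondFundamentalCLM hE hmin hy, smul_zero, H.source.symm y hy v u,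
    H.secondFundamentalCLM_symm hy v u] at htr
  rw [← sub_eq_zero, htr]
  module

theorem secondFundamentalCLM_null : secondFundamentalCLM G G' F y e₁ e₂ = 0 := by
  have htr := h.metricTrace_eq hE (H.source.isInvertible hy) (secondFundamentalCLM G G' F y)
  rw [H.metricTrace_secondFundamentalCLM hE hmin hy, H.secondFundamentalCLM_symm hy e₂ e₁] at htr
  simpa [← two_smul ℝ] using htr

theorem secondFundamentalCLM_null_left (u : E) : secondFundamentalCLM G G' F y u e₂
    = -G y u e₁ • secondFundamentalCLM G G' F y e₂ e₂ := by
  conv_lhs => rw [h.eq_smul_add_smul hE u]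
  simp [H.secondFundamentalCLM_null hE hmin hy h]

theorem secondFundamentalCLM_null_right (u : E) : secondFundamentalCLM G G' F y e₁ u
    = -G y u e₂ • secondFundamentalCLM G G' F y e₁ e₁ := by
  conv_lhs => rw [h.eq_smul_add_smul hE u]
  simp [H.secondFundamentalCLM_null hE hmin hy h]

end IsCoordinateImmersion

end SlantImmersion

section MinimalFlatSlant

variable {E : Type*} [NormedAddCommGroup E] [NormedSpace ℝ E]
  {E' : Type*} [NormedAddCommGroup E'] [NormedSpace ℝ E']
  {U : Set E} {V : Set E'} {G : E → E →L[ℝ] E →L[ℝ] ℝ} {G' : E' → E' →L[ℝ] E' →L[ℝ] ℝ}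
  {J : E' → E' →L[ℝ] E'} {s : ℝ} {F : E → E'} {y : E}

theorem IsCoordinateImmersion.covDerivSecondFundamental_null [FiniteDimensional ℝ E]
    [FiniteDimensional ℝ E'] (H : IsCoordinateImmersion U V G G' F) (hE : Module.finrank ℝ E = 2)
    (hmin : ∀ y ∈ U, meanCurvature G G' F y = 0)
    (hpair : ∀ y ∈ U, ∃ e₁ e₂, IsNullPair (G y) e₁ e₂) (hy : y ∈ U) {e₁ e₂ : E}
    (h : IsNullPair (G y) e₁ e₂) (x : E) : covDerivSecondFundamental G G' F y x e₁ e₂ = 0 := by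
  -- `e₁, e₂` is a null pair only at `y`, so minimality is differentiated in the form it takes
  -- for arbitrary vectors
  have hev : (fun z => G z e₂ e₂ • secondFundamentalCLM G G' F z e₁ e₁
        + G z e₁ e₁ • secondFundamentalCLM G G' F z e₂ e₂) =ᶠ[nhds y]
      fun z => (2 * G z e₁ e₂) • secondFundamentalCLM G G' F z e₁ e₂ :=
    Filter.eventuallyEq_of_mem (H.mem_nhds hy) fun z hz => by
      obtain ⟨_, _, hz_pair⟩ := hpair z hz
      exact H.smul_secondFundamentalCLM_add hE hmin hz hz_pair e₁ e₂
  have hG := H.source.differentiableAt_apply hy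
  have hII := H.differentiableAt_secondFundamentalCLM hy
  have hfderiv (a b : E) : fderiv ℝ (fun z => G z a b) y x
      = G y (christoffel G y x a) b + G y (christoffel G y x b) a := by
    rw [fderiv_clm_apply₂_const (H.source.differentiableAt hy), H.source.fderiv_eq hy,
      H.source.symm y hy a]
  have hd := covDerivAlong_congr (G' := G') (F := F) hev x
  rw [covDerivAlong_add ((hG e₂ e₂).fun_smul (hII e₁ e₁)) ((hG e₁ e₁).fun_smul (hII e₂ e₂)),
    covDerivAlong_smul (hG e₂ e₂) (hII e₁ e₁), covDerivAlong_smul (hG e₁ e₁) (hII e₂ e₂),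
    covDerivAlong_smul ((hG e₁ e₂).const_mul 2) (hII e₁ e₂), hfderiv, hfderiv, h.self₁, h.self₂,
    h.mixed, H.secondFundamentalCLM_null hE hmin hy h] at hd
  rw [covDerivSecondFundamental, H.secondFundamentalCLM_null_left hE hmin hy h,
    H.secondFundamentalCLM_null_right hE hmin hy h]
  linear_combination (norm := module) (1 / 2 : ℝ) • hd

namespace IsSlantImmersion

variable (H : IsSlantImmersion U V G G' J s F) (hE : Module.finrank ℝ E = 2) (hs : s ≠ 0)
  (hy : y ∈ U) {e₁ e₂ : E} (h : IsSlantPair G G' J F s y e₁ e₂)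

include H hE hy

include hs h in
theorem fderiv_kahlerForm_slant (x : E) : fderiv ℝ (fun z => kahlerForm G' J F z e₁ e₂) y x
    = s * fderiv ℝ G y x e₁ e₂ := by
  have hev : (fun z => kahlerForm G' J F z e₁ e₂ ^ 2) =ᶠ[nhds y]
      fun z => s ^ 2 * (G z e₁ e₂ * G z e₂ e₁ - G z e₁ e₁ * G z e₂ e₂) :=
    Filter.eventuallyEq_of_mem (H.mem_nhds hy) fun z hz => by
      obtain ⟨f₁, f₂, hf⟩ := H.exists_isSlantPair z hz
      simp only [hf.skew_sq_eq hE (H.kahlerForm_skew hz) e₁ e₂, hf.kahlerForm_eq, neg_sq]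
  have hG := H.source.differentiableAt_apply hy
  have hfderiv (a b : E) : fderiv ℝ (fun z => G z a b) y x = fderiv ℝ G y x a b :=
    fderiv_clm_apply₂_const (H.source.differentiableAt hy) x a b
  have hd := congr($(hev.fderiv_eq (𝕜 := ℝ)) x)
  rw [fderiv_fun_pow 2 (H.differentiableAt_kahlerForm hy e₁ e₂),
    fderiv_const_mul (((hG e₁ e₂).fun_mul (hG e₂ e₁)).fun_sub ((hG e₁ e₁).fun_mul (hG e₂ e₂))),
    fderiv_fun_sub ((hG e₁ e₂).fun_mul (hG e₂ e₁)) ((hG e₁ e₁).fun_mul (hG e₂ e₂)),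
    fderiv_fun_mul (hG e₁ e₂) (hG e₂ e₁), fderiv_fun_mul (hG e₁ e₁) (hG e₂ e₂)] at hd
  simp only [smul_apply, add_apply, sub_apply, smul_eq_mul, hfderiv, h.kahlerForm_eq, h.self₁,
    h.self₂, h.mixed, h.mixed', H.source.fderiv_symm hy x e₂ e₁] at hd
  refine mul_left_cancel₀ hs ?_
  linear_combination (-1 / 2) * hd

variable [FiniteDimensional ℝ E] [FiniteDimensional ℝ E']

include hs in
theorem cubicForm_symm (x v w : E) :
    cubicForm G G' J F y x v w = cubicForm G G' J F y x w v := by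
  obtain ⟨e₁, e₂, h⟩ := H.exists_isSlantPair y hy
  have hpair : cubicForm G G' J F y x e₁ e₂ = cubicForm G G' J F y x e₂ e₁ := by
    have hd := H.fderiv_kahlerForm_slant hE hs hy h x
    rw [H.fderiv_kahlerForm hy, H.source.fderiv_eq hy, h.skew_apply_add hE (H.kahlerForm_skew hy),
      h.kahlerForm_eq, H.source.symm y hy e₁] at hd
    linarith
  let C : E →L[ℝ] E →L[ℝ] ℝ := (G' (F y)).bilinearComp (secondFundamentalCLM G G' F y x)
    ((J (F y)).comp (fderiv ℝ F y))
  exact sub_eq_zero.1 <| h.skew_eq_zero (Ω := C - C.flip) hE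
    (fun u v => (neg_sub (C v u) (C u v)).symm) (sub_eq_zero.2 hpair) v w

include hs in
theorem inner_covDerivSecondFundamental_endo_add_symm (x u v w : E) :
    G' (F y) (covDerivSecondFundamental G G' F y x u v) (J (F y) (fderiv ℝ F y w))
        + G' (F y) (secondFundamentalCLM G G' F y u v)
          (J (F y) (secondFundamentalCLM G G' F y x w))
      = G' (F y) (covDerivSecondFundamental G G' F y x u w) (J (F y) (fderiv ℝ F y v))
        + G' (F y) (secondFundamentalCLM G G' F y u w)
          (J (F y) (secondFundamentalCLM G G' F y x v)) := by
  have hev : (fun z => cubicForm G G' J F z u v w) =ᶠ[nhds y]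
      fun z => cubicForm G G' J F z u w v :=
    Filter.eventuallyEq_of_mem (H.mem_nhds hy) fun z hz => H.cubicForm_symm hE hs hz u v w
  have hd := congr($(hev.fderiv_eq (𝕜 := ℝ)) x)
  rw [H.fderiv_cubicForm hy, H.fderiv_cubicForm hy, H.cubicForm_symm hE hs hy _ v w,
    H.cubicForm_symm hE hs hy u _ w, H.cubicForm_symm hE hs hy u v _] at hd
  linarith

section MinimalFlat

variable {c : ℝ} (hmin : ∀ y ∈ U, meanCurvature G G' F y = 0)
  (hflat : ∀ y ∈ U, ∀ u v w, curvature G y u v w = 0)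
  (hcurv : HasConstantHolomorphicCurvatureOn G' J c V)

include hmin hflat hcurv h

theorem covDerivSecondFundamental_slant : covDerivSecondFundamental G G' F y e₂ e₁ e₁
    = c • (fderiv ℝ F y e₁ - (3 * s) • J (F y) (fderiv ℝ F y e₁)) := by
  have hCodazzi := H.covDerivSecondFundamental_sub hy e₁ e₂ e₁
  have hnull := H.covDerivSecondFundamental_null hE hmin H.exists_isNullPair hy h.toIsNullPair e₁
  have hΩ₁₁ : kahlerForm G' J F y e₁ e₁ = 0 := by linarith [H.kahlerForm_skew hy e₁ e₁]
  have hΩ₂₁ : kahlerForm G' J F y e₂ e₁ = s := by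
    rw [H.kahlerForm_skew hy, h.kahlerForm_eq, neg_neg]
  rw [hflat y hy, map_zero, hcurv _ (H.mapsTo y hy), H.covDerivSecondFundamental_symm hy, hnull,
    ← H.induced y hy, ← H.induced y hy, h.self₁, h.mixed', ← kahlerForm_apply, ← kahlerForm_apply,
    hΩ₁₁, hΩ₂₁, H.inner_symm hy _ (J (F y) _), ← kahlerForm_apply, hΩ₂₁] at hCodazzi
  linear_combination (norm := module) -hCodazzi

theorem inner_secondFundamentalCLM_slant :
    G' (F y) (secondFundamentalCLM G G' F y e₁ e₁) (secondFundamentalCLM G G' F y e₂ e₂)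
      = c * (1 - 3 * s ^ 2) := by
  have hd := H.inner_covDerivSecondFundamental_fderiv hy e₂ e₁ e₁ e₂
  rw [H.covDerivSecondFundamental_slant hE hy h hmin hflat hcurv] at hd
  simp only [map_smul, map_sub, smul_apply, sub_apply, smul_eq_mul, ← H.induced y hy,
    ← kahlerForm_apply, h.mixed, h.kahlerForm_eq] at hd
  linear_combination hd

include hs in
theorem inner_secondFundamentalCLM_endo_slant :
    G' (F y) (secondFundamentalCLM G G' F y e₁ e₁) (J (F y) (secondFundamentalCLM G G' F y e₂ e₂))
      = -4 * c * s := by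
  have hd := H.inner_covDerivSecondFundamental_endo_add_symm hE hs hy e₂ e₁ e₁ e₂
  rw [H.covDerivSecondFundamental_slant hE hy h hmin hflat hcurv,
    H.covDerivSecondFundamental_null hE hmin H.exists_isNullPair hy h.toIsNullPair,
    H.secondFundamentalCLM_null hE hmin hy h.toIsNullPair] at hd
  simp only [map_smul, map_sub, map_zero, zero_apply, smul_apply, sub_apply, smul_eq_mul,
    H.orthogonal _ (H.mapsTo y hy), ← H.induced y hy,
    H.inner_symm hy (fderiv ℝ F y _) (J (F y) _), ← kahlerForm_apply, h.mixed,
    H.kahlerForm_skew hy e₂ e₁, h.kahlerForm_eq] at hd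
  linear_combination hd

end MinimalFlat

theorem slant_eq_zero (hE' : Module.finrank ℝ E' = 4) {c : ℝ} (hc : c ≠ 0)
    (hmin : ∀ y ∈ U, meanCurvature G G' F y = 0)
    (hflat : ∀ y ∈ U, ∀ u v w, curvature G y u v w = 0)
    (hcurv : HasConstantHolomorphicCurvatureOn G' J c V) : s = 0 := by
  by_contra hs
  obtain ⟨e₁, e₂, h⟩ := H.exists_isSlantPair y hy
  have hGauss := H.inner_secondFundamentalCLM_slant hE hy h hmin hflat hcurv
  have hCodazzi := H.inner_secondFundamentalCLM_endo_slant hE hs hy h hmin hflat hcurv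
  have hcubic : cubicForm G G' J F y e₂ e₂ e₁ = 0 := by
    rw [H.cubicForm_symm hE hs hy, cubicForm, H.secondFundamentalCLM_symm hy e₂ e₁,
      H.secondFundamentalCLM_null hE hmin hy h.toIsNullPair, map_zero, zero_apply]
  obtain ⟨b, hb⟩ : ∃ b : ℝ, secondFundamentalCLM G G' F y e₂ e₂
      = b • (J (F y) (fderiv ℝ F y e₁) - s • fderiv ℝ F y e₁) :=
    IsNullPair.exists_eq_smul_of_orthogonal hE' (H.inner_symm hy) (H.sq _ (H.mapsTo y hy))
      (H.orthogonal _ (H.mapsTo y hy)) (H.isNullPair_fderiv hy h.toIsNullPair) h.kahlerForm_eq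
      (H.inner_secondFundamentalCLM_fderiv hy e₂ e₂ e₁)
      (H.inner_secondFundamentalCLM_fderiv hy e₂ e₂ e₂) hcubic
  rw [hb] at hGauss hCodazzi
  simp only [map_smul, map_sub, smul_eq_mul, H.sq _ (H.mapsTo y hy), map_neg,
    H.inner_secondFundamentalCLM_fderiv hy] at hGauss hCodazzi
  have hprod : c * s * (3 * (1 + s ^ 2)) = 0 := by linear_combination s * hGauss + hCodazzi
  exact mul_ne_zero (mul_ne_zero hc hs) (by positivity) hprod

end IsSlantImmersion

end MinimalFlatSlant

section ChartDomain

variable {E M E' N : Type*} [TopologicalSpace E] [TopologicalSpace M] [TopologicalSpace E']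
  [TopologicalSpace N] {f : M → N} {e : OpenPartialHomeomorph M E}
  {e' : OpenPartialHomeomorph N E'}

/-- The domain of the coordinate expression of `f` in the charts `e` and `e'`. -/
def chartDomain (f : M → N) (e : OpenPartialHomeomorph M E) (e' : OpenPartialHomeomorph N E') :
    Set E :=
  e.target ∩ e.symm ⁻¹' (f ⁻¹' e'.source)

/-- The coordinate expression `e' ∘ f ∘ e⁻¹` of `f` in the charts `e` and `e'`; meaningful on
`chartDomain f e e'`. -/
def mapInCharts (f : M → N) (e : OpenPartialHomeomorph M E) (e' : OpenPartialHomeomorph N E')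
    (y : E) : E' :=
  e' (f (e.symm y))

theorem mem_chartDomain {p : M} (hp : p ∈ e.source) (hq : f p ∈ e'.source) :
    e p ∈ chartDomain f e e' :=
  ⟨e.map_source hp, by rwa [Set.mem_preimage, Set.mem_preimage, e.left_inv hp]⟩

theorem isOpen_chartDomain (hf : Continuous f) : IsOpen (chartDomain f e e') :=
  e.isOpen_inter_preimage_symm (e'.open_source.preimage hf)

end ChartDomain

section Charts

variable {E : Type*} [NormedAddCommGroup E] [NormedSpace ℝ E]
  {M : Type*} [TopologicalSpace M] [ChartedSpace E M]

section Tensors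

variable {e : OpenPartialHomeomorph M E} (he : e.MDifferentiable 𝓘(ℝ, E) 𝓘(ℝ, E))

include he

theorem mfderiv_symm_mfderiv {y : E} (hy : y ∈ e.target)
    (X : TangentSpace 𝓘(ℝ, E) (e.symm y)) :
    mfderiv 𝓘(ℝ, E) 𝓘(ℝ, E) e.symm y (mfderiv 𝓘(ℝ, E) 𝓘(ℝ, E) e (e.symm y) X) = X := by
  have h := DFunLike.congr_fun (he.symm_comp_deriv (e.map_target hy)) X
  rwa [e.right_inv hy] at h

theorem inChart_mfderiv {p : M} (hp : p ∈ e.source) (g : BilinField E M)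
    (X Y : TangentSpace 𝓘(ℝ, E) p) :
    g.inChart e (e p) (mfderiv 𝓘(ℝ, E) 𝓘(ℝ, E) e p X) (mfderiv 𝓘(ℝ, E) 𝓘(ℝ, E) e p Y)
      = g p X Y := by
  obtain ⟨y, hy, rfl⟩ : ∃ y ∈ e.target, e.symm y = p := ⟨e p, e.map_source hp, e.left_inv hp⟩
  rw [e.right_inv hy]
  exact congr(g (e.symm y) $(mfderiv_symm_mfderiv he hy X) $(mfderiv_symm_mfderiv he hy Y))

theorem endo_inChart_mfderiv {p : M} (hp : p ∈ e.source) (J : EndoField E M)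
    (X : TangentSpace 𝓘(ℝ, E) p) :
    J.inChart e (e p) (mfderiv 𝓘(ℝ, E) 𝓘(ℝ, E) e p X)
      = mfderiv 𝓘(ℝ, E) 𝓘(ℝ, E) e p (J p X) := by
  obtain ⟨y, hy, rfl⟩ : ∃ y ∈ e.target, e.symm y = p := ⟨e p, e.map_source hp, e.left_inv hp⟩
  rw [e.right_inv hy]
  exact congr(mfderiv 𝓘(ℝ, E) 𝓘(ℝ, E) e (e.symm y)
    (J (e.symm y) $(mfderiv_symm_mfderiv he hy X)))

theorem inChart_nondegenerate {g : BilinField E M}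
    (hg : ∀ x u, (∀ v, g x u v = 0) → u = 0) {y : E} (hy : y ∈ e.target) (u : E)
    (hu : ∀ v, g.inChart e y u v = 0) : u = 0 := by
  have hDu : mfderiv 𝓘(ℝ, E) 𝓘(ℝ, E) e.symm y u = 0 :=
    hg _ _ ((he.symm.mfderiv_surjective hy).forall.2 hu)
  exact he.symm.mfderiv_injective hy (hDu.trans (map_zero _).symm)

theorem endo_inChart_sq {J : EndoField E M} (hJ : ∀ x u, J x (J x u) = -u) {y : E}
    (hy : y ∈ e.target) (u : E) : J.inChart e y (J.inChart e y u) = -u := by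
  obtain ⟨p, hp, rfl⟩ : ∃ p ∈ e.source, e p = y := ⟨e.symm y, e.map_target hy, e.right_inv hy⟩
  obtain ⟨X, rfl⟩ := he.mfderiv_surjective hp u
  rw [endo_inChart_mfderiv he hp, endo_inChart_mfderiv he hp, hJ]
  exact map_neg _ _

theorem inChart_endo_endo {g : BilinField E M} {J : EndoField E M}
    (hJ : ∀ x u v, g x (J x u) (J x v) = g x u v) {y : E} (hy : y ∈ e.target) (u v : E) :
    g.inChart e y (J.inChart e y u) (J.inChart e y v) = g.inChart e y u v := by
  obtain ⟨p, hp, rfl⟩ : ∃ p ∈ e.source, e p = y := ⟨e.symm y, e.map_target hy, e.right_inv hy⟩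
  obtain ⟨X, rfl⟩ := he.mfderiv_surjective hp u
  obtain ⟨Y, rfl⟩ := he.mfderiv_surjective hp v
  rw [endo_inChart_mfderiv he hp, endo_inChart_mfderiv he hp, inChart_mfderiv he hp,
    inChart_mfderiv he hp, hJ]

end Tensors

section Maps

variable {E' : Type*} [NormedAddCommGroup E'] [NormedSpace ℝ E']
  {N : Type*} [TopologicalSpace N] [ChartedSpace E' N] {f : M → N}
  {e : OpenPartialHomeomorph M E} {e' : OpenPartialHomeomorph N E'}

theorem contDiffOn_mapInCharts (hf : ContMDiff 𝓘(ℝ, E) 𝓘(ℝ, E') ∞ f) (he : e ∈ charts E M)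
    (he' : e' ∈ charts E' N) : ContDiffOn ℝ ∞ (mapInCharts f e e') (chartDomain f e e') :=
  contMDiffOn_iff_contDiffOn.1 <| (contMDiffOn_of_mem_maximalAtlas he').comp
    (hf.comp_contMDiffOn ((contMDiffOn_symm_of_mem_maximalAtlas he).mono Set.inter_subset_left))
    fun _ hy => hy.2

theorem mdifferentiable_of_mem_charts (he : e ∈ charts E M) :
    e.MDifferentiable 𝓘(ℝ, E) 𝓘(ℝ, E) :=
  ⟨(contMDiffOn_of_mem_maximalAtlas he).mdifferentiableOn (by simp),
    (contMDiffOn_symm_of_mem_maximalAtlas he).mdifferentiableOn (by simp)⟩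

theorem fderiv_mapInCharts (hf : MDifferentiable 𝓘(ℝ, E) 𝓘(ℝ, E') f)
    (he : e.MDifferentiable 𝓘(ℝ, E) 𝓘(ℝ, E)) (he' : e'.MDifferentiable 𝓘(ℝ, E') 𝓘(ℝ, E')) {y : E}
    (hy : y ∈ chartDomain f e e') (u : E) : fderiv ℝ (mapInCharts f e e') y u
      = mfderiv 𝓘(ℝ, E') 𝓘(ℝ, E') e' (f (e.symm y)) (mfderiv 𝓘(ℝ, E) 𝓘(ℝ, E') f (e.symm y)
        (mfderiv 𝓘(ℝ, E) 𝓘(ℝ, E) e.symm y u)) := by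
  have hcomp := (he'.mdifferentiableAt hy.2).hasMFDerivAt.comp y
    ((hf _).hasMFDerivAt.comp y (he.mdifferentiableAt_symm hy.1).hasMFDerivAt)
  rw [← mfderiv_eq_fderiv]
  exact congr($(hcomp.mfderiv) u)

theorem inChart_inducedMetric (g : BilinField E' N) (hf : MDifferentiable 𝓘(ℝ, E) 𝓘(ℝ, E') f)
    (he : e.MDifferentiable 𝓘(ℝ, E) 𝓘(ℝ, E)) (he' : e'.MDifferentiable 𝓘(ℝ, E') 𝓘(ℝ, E')) {y : E}
    (hy : y ∈ chartDomain f e e') (u v : E) :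
    (inducedMetric (E := E) g f).inChart e y u v = g.inChart e' (mapInCharts f e e' y)
      (fderiv ℝ (mapInCharts f e e') y u) (fderiv ℝ (mapInCharts f e e') y v) := by
  rw [fderiv_mapInCharts hf he he' hy, fderiv_mapInCharts hf he he' hy]
  exact (inChart_mfderiv he' hy.2 g _ _).symm

end Maps

end Charts

section Surfaces

variable {E : Type*} [NormedAddCommGroup E] [NormedSpace ℝ E]
  {M : Type*} [TopologicalSpace M] [ChartedSpace E M]
  {E' : Type*} [NormedAddCommGroup E'] [NormedSpace ℝ E']
  {N : Type*} [TopologicalSpace N] [ChartedSpace E' N]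
  {g : BilinField E' N} {J : EndoField E' N} {f : M → N}

section Charts

variable {e : OpenPartialHomeomorph M E} {e' : OpenPartialHomeomorph N E'}

theorem IsPseudoRiemannian.isMetricOn_inChart (hg : IsPseudoRiemannian g)
    (he' : e' ∈ charts E' N) : IsMetricOn (g.inChart e') e'.target where
  isOpen := e'.open_target
  smooth := hg.smooth e' he'
  symm _ _ _ _ := hg.symm _ _ _
  nondegenerate _ hy :=
    inChart_nondegenerate (mdifferentiable_of_mem_charts he') hg.nondegenerate hy

theorem IsLorentzianImmersion.isKahlerImmersion_mapInCharts [FiniteDimensional ℝ E]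
    (hf : IsLorentzianImmersion (E := E) g f) (hN : IsKahler g J) (he : e ∈ charts E M)
    (he' : e' ∈ charts E' N) :
    IsKahlerImmersion (chartDomain f e e') e'.target ((inducedMetric (E := E) g f).inChart e)
      (g.inChart e') (J.inChart e') (mapInCharts f e e') := by
  have hdf := hf.smooth.mdifferentiable (by simp)
  have hde := mdifferentiable_of_mem_charts he
  have hde' := mdifferentiable_of_mem_charts he'
  have hmaps : ∀ y ∈ chartDomain f e e', mapInCharts f e e' y ∈ e'.target :=
    fun _ hy => e'.map_source hy.2
  have hsmooth := contDiffOn_mapInCharts hf.smooth he he'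
  have hmetric := hN.metric.isMetricOn_inChart he'
  have hinduced : ∀ y ∈ chartDomain f e e', ∀ u v, _ := fun y hy u v =>
    inChart_inducedMetric g hdf hde hde' hy u v
  exact
    { source := .of_induced (isOpen_chartDomain hf.smooth.continuous) hmetric hmaps hsmooth
        hinduced fun _ hy => inChart_nondegenerate hde hf.nondegenerate hy.1
      target := hmetric
      mapsTo := hmaps
      smooth := hsmooth
      induced := hinduced
      smooth_endo := hN.smooth e' he'
      sq := fun _ hy => endo_inChart_sq hde' hN.sq hy
      orthogonal := fun _ hy => inChart_endo_endo hde' hN.orthogonal hy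
      parallel := hN.parallel e' he' }

theorem kahlerForm_inChart (hf : MDifferentiable 𝓘(ℝ, E) 𝓘(ℝ, E') f)
    (he : e.MDifferentiable 𝓘(ℝ, E) 𝓘(ℝ, E)) (he' : e'.MDifferentiable 𝓘(ℝ, E') 𝓘(ℝ, E')) {y : E}
    (hy : y ∈ chartDomain f e e') (u v : E) :
    kahlerForm (g.inChart e') (J.inChart e') (mapInCharts f e e') y u v
      = g (f (e.symm y)) (J (f (e.symm y)) (mfderiv 𝓘(ℝ, E) 𝓘(ℝ, E') f (e.symm y)
          (mfderiv 𝓘(ℝ, E) 𝓘(ℝ, E) e.symm y u)))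
        (mfderiv 𝓘(ℝ, E) 𝓘(ℝ, E') f (e.symm y) (mfderiv 𝓘(ℝ, E) 𝓘(ℝ, E) e.symm y v)) := by
  rw [kahlerForm_apply, fderiv_mapInCharts hf he he' hy, fderiv_mapInCharts hf he he' hy,
    mapInCharts, endo_inChart_mfderiv he' hy.2, inChart_mfderiv he' hy.2]

theorem IsSlant.isSlantImmersion_mapInCharts [FiniteDimensional ℝ E] {θ : ℝ}
    (hθ : IsSlant (E := E) g J f θ) (hf : IsLorentzianImmersion (E := E) g f) (hN : IsKahler g J)
    (he : e ∈ charts E M) (he' : e' ∈ charts E' N) :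
    IsSlantImmersion (chartDomain f e e') e'.target ((inducedMetric (E := E) g f).inChart e)
      (g.inChart e') (J.inChart e') (Real.sinh θ) (mapInCharts f e e') where
  toIsKahlerImmersion := hf.isKahlerImmersion_mapInCharts hN he he'
  exists_isSlantPair y hy := by
    have hde := mdifferentiable_of_mem_charts he
    obtain ⟨e₁, e₂, ⟨h₁, h₂, h₁₂⟩, hP, -⟩ := hθ (e.symm y)
    obtain ⟨u₁, rfl⟩ := hde.symm.mfderiv_surjective hy.1 e₁
    obtain ⟨u₂, rfl⟩ := hde.symm.mfderiv_surjective hy.1 e₂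
    refine ⟨u₁, u₂, ⟨h₁, h₂, h₁₂, (hN.metric.symm _ _ _).trans h₁₂⟩, ?_⟩
    have hP₂ := hP (mfderiv 𝓘(ℝ, E) 𝓘(ℝ, E) e.symm y u₂)
    rw [map_sub, map_smul, map_smul, sub_apply, smul_apply, sub_eq_zero] at hP₂
    calc kahlerForm (g.inChart e') (J.inChart e') (mapInCharts f e e') y u₁ u₂
      _ = _ := kahlerForm_inChart (hf.smooth.mdifferentiable (by simp)) hde
        (mdifferentiable_of_mem_charts he') hy u₁ u₂
      _ = _ := hP₂
      _ = _ := congrArg (Real.sinh θ • ·) h₁₂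
      _ = -Real.sinh θ := mul_neg_one _

end Charts

theorem IsSlant.sinh_eq_zero [FiniteDimensional ℝ E] [FiniteDimensional ℝ E']
    [IsManifold 𝓘(ℝ, E) ∞ M] [IsManifold 𝓘(ℝ, E') ∞ N] [Nonempty M]
    (hE : Module.finrank ℝ E = 2) (hE' : Module.finrank ℝ E' = 4) {c : ℝ} (hc : c ≠ 0)
    (hN : IsKahler g J) (hcurv : ∀ e ∈ charts E' N,
      HasConstantHolomorphicCurvatureOn (g.inChart e) (J.inChart e) c e.target)
    (hf : IsLorentzianImmersion (E := E) g f) (hmin : IsMinimal (E := E) g f)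
    (hflat : IsFlat (inducedMetric (E := E) g f)) {θ : ℝ} (hθ : IsSlant (E := E) g J f θ) :
    Real.sinh θ = 0 := by
  obtain ⟨x⟩ := ‹Nonempty M›
  have he := IsManifold.chart_mem_maximalAtlas (I := 𝓘(ℝ, E)) (n := ∞) x
  have he' := IsManifold.chart_mem_maximalAtlas (I := 𝓘(ℝ, E')) (n := ∞) (f x)
  exact (hθ.isSlantImmersion_mapInCharts hf hN he he').slant_eq_zero hE
    (mem_chartDomain (mem_chart_source E x) (mem_chart_source E' (f x))) hE' hc
    (fun y hy => hmin _ he _ he' y hy.1 hy.2) (fun y hy => hflat _ he y hy.1) (hcurv _ he')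

theorem HasIndexOne.exists_isPseudoOrthonormal {g : BilinField E M} (hg : HasIndexOne g)
    (hE : 1 < Module.finrank ℝ E) {x : M} (hsymm : ∀ u v, g x u v = g x v u)
    (hnd : ∀ u, (∀ v, g x u v = 0) → u = 0) : ∃ e₁ e₂, IsPseudoOrthonormal g x e₁ e₂ := by
  obtain ⟨⟨W, hW, hW_rank⟩, hmax⟩ := hg x
  obtain ⟨u, huW, hu⟩ := W.exists_mem_ne_zero_of_ne_bot (by rintro rfl; simp at hW_rank)
  obtain ⟨w, hw, hww⟩ : ∃ w, w ≠ 0 ∧ 0 ≤ g x w w := by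
    by_contra! hneg
    exact (hmax ⊤ fun w _ => hneg w).not_gt (finrank_top ℝ E ▸ hE)
  obtain ⟨e₁, he₁, hnull⟩ := exists_null_vector (E := E) (hW u huW hu) hw hww
  obtain ⟨e₂, h⟩ := exists_isNullPair (E := E) hsymm hnd he₁ hnull
  exact ⟨e₁, e₂, h.self₁, h.self₂, h.mixed⟩

theorem isSlant_zero_iff_isLagrangian (hE : Module.finrank ℝ E = 2)
    (hsymm : ∀ q u v, g q u v = g q v u) (hf : IsLorentzianImmersion (E := E) g f) :
    IsSlant (E := E) g J f 0 ↔ IsLagrangian (E := E) g J f := by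
  refine ⟨fun h x u w => ?_, fun hL x => ?_⟩
  · obtain ⟨e₁, e₂, ⟨h₁, h₂, h₁₂⟩, hP₁, hP₂⟩ := h x
    have hPe₁ := hP₁ w
    have hPe₂ := hP₂ w
    simp only [Real.sinh_zero, neg_zero, zero_smul, map_zero, sub_zero] at hPe₁ hPe₂
    have hpair : IsNullPair (E := E) (inducedMetric (E := E) g f x) e₁ e₂ :=
      ⟨h₁, h₂, h₁₂, (hsymm _ _ _).trans h₁₂⟩
    obtain ⟨a, b, rfl⟩ : ∃ a b : ℝ, u = a • e₁ + b • e₂ := ⟨_, _, hpair.eq_smul_add_smul hE u⟩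
    simp only [map_add, map_smul, add_apply, smul_apply, hPe₁, hPe₂, smul_zero, add_zero]
  · obtain ⟨e₁, e₂, h⟩ := hf.index.exists_isPseudoOrthonormal (by lia)
      (fun u v => hsymm _ _ _) (hf.nondegenerate x)
    exact ⟨e₁, e₂, h, fun w => by simpa using hL x e₁ w,
      fun w => by simpa using hL x e₂ w⟩

end Surfaces

end LorentzSurface

end

open LorentzSurface in
theorem lemma6p1_general
    {E : Type*} [NormedAddCommGroup E] [NormedSpace ℝ E] [FiniteDimensional ℝ E]
    {M : Type*} [TopologicalSpace M] [ChartedSpace E M] [IsManifold 𝓘(ℝ, E) ∞ M] [Nonempty M]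
    {E' : Type*} [NormedAddCommGroup E'] [NormedSpace ℝ E'] [FiniteDimensional ℝ E']
    {N : Type*} [TopologicalSpace N] [ChartedSpace E' N] [IsManifold 𝓘(ℝ, E') ∞ N]
    {g : BilinField E' N} {J : EndoField E' N} {f : M → N} {c : ℝ}
    (hE : Module.finrank ℝ E = 2) (hE' : Module.finrank ℝ E' = 4) (hc : c ≠ 0)
    (hN : IsKahler g J) (hcurv : ∀ e ∈ charts E' N,
      HasConstantHolomorphicCurvatureOn (g.inChart e) (J.inChart e) c e.target)
    (hf : IsLorentzianImmersion (E := E) g f) (hmin : IsMinimal (E := E) g f)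
    (hflat : IsFlat (inducedMetric (E := E) g f)) (θ : ℝ) :
    IsSlant (E := E) g J f θ ↔ θ = 0 ∧ IsLagrangian (E := E) g J f := by
  rw [← isSlant_zero_iff_isLagrangian hE hN.metric.symm hf]
  refine ⟨fun hθ => ?_, fun ⟨h₀, h⟩ => h₀ ▸ h⟩
  have h₀ : θ = 0 := Real.sinh_eq_zero.1 (hθ.sinh_eq_zero hE hE' hc hN hcurv hf hmin hflat)
  exact ⟨h₀, h₀ ▸ hθ⟩

theorem lemma6p1
    {N : Type*} [TopologicalSpace N] [ChartedSpace (EuclideanSpace ℝ (Fin 4)) N]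
    [IsManifold 𝓘(ℝ, EuclideanSpace ℝ (Fin 4)) ∞ N]
    (g : LorentzSurface.BilinField (EuclideanSpace ℝ (Fin 4)) N)
    (J : LorentzSurface.EndoField (EuclideanSpace ℝ (Fin 4)) N)
    (c : ℝ) (hc : c ≠ 0) (hN : LorentzSurface.IsLorentzianComplexSpaceForm g J c)
    {M : Type*} [TopologicalSpace M] [ChartedSpace (EuclideanSpace ℝ (Fin 2)) M]
    [IsManifold 𝓘(ℝ, EuclideanSpace ℝ (Fin 2)) ∞ M] [Nonempty M]
    (f : M → N)
    (hf : LorentzSurface.IsLorentzianImmersion (E := EuclideanSpace ℝ (Fin 2)) g f)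
    (hmin : LorentzSurface.IsMinimal (E := EuclideanSpace ℝ (Fin 2)) g f)
    (hflat : LorentzSurface.IsFlat
      (LorentzSurface.inducedMetric (E := EuclideanSpace ℝ (Fin 2)) g f))
    (θ : ℝ) :
    LorentzSurface.IsSlant (E := EuclideanSpace ℝ (Fin 2)) g J f θ ↔
      θ = 0 ∧ LorentzSurface.IsLagrangian (E := EuclideanSpace ℝ (Fin 2)) g J f := by
  exact lemma6p1_general (by simp) (by simp) hc hN.kahler hN.curvature_eq hf hmin hflat θ
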